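/- Let $S^1=\mathbb R/2\pi\mathbb Z$, and let $G=S^1\times_c\mathrm{Diff}^+(S^1)$ be the Virasoro–Bott group, with multiplication $(\varphi,\alpha)(\psi,\beta)=(\varphi\circ\psi,\ \alpha\beta e^{2\pi i c(\varphi,\psi)})$, where $c(\varphi,\psi)=\int_{S^1}\log(\varphi\circ\psi)'\,d\log\psi'$. Its Lie algebra $\mathfrak g$ consists of the pairs $(h,a)$, $h\in C^\infty(S^1,\mathbb R)$, $a\in\mathbb R$, where $(h,a)$ is the velocity at $t=0$ of $t\mapsto(\mathrm{id}+th,\ e^{4\pi i a t})$; in this normalization the bracket is $[(h,a),(k,b)]=(h'k-hk',\ \omega(h,k))$ with $\omega(h,k)=\omega(h)k=\int_{S^1}h'k''\,dx$. Equip $G$ with the right-invariant weak Riemannian metric that at the identity is $\langle(h,a),(k,b)\rangle=\int_{S^1}hk\,dx+ab$. Let $\nabla$ be its Levi-Civita covariant derivative and $\mathcal R(X,Y)=[\nabla_X,\nabla_Y]-\nabla_{[X,Y]}$ its curvature; vectors $(h,a)\in\mathfrak g$ are identified with tangent vectors at any point of $G$ by right translation, and with right-invariant vector fields. Put $\partial=d/dx$.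 The curvature $\mathcal R(X_1,X_2)X_3$ of right-invariant vector fields exists and is unique, and the following hold for all $(h_i,a_i)\in\mathfrak g$, at every point of $G$. 1. $4\mathcal R((h_1,a_1),(h_2,a_2))$ is the operator matrix $\begin{pmatrix}A_{11}&A_{12}\\A_{21}&0\end{pmatrix}$ acting on columns $\binom{h_3}{a_3}$, where $$A_{11}=4(h_1h_2''-h_1''h_2)+2(a_1h_2^{(4)}-a_2h_1^{(4)})+\bigl(8(h_1h_2'-h_1'h_2)+10(a_1h_2'''-a_2h_1''')\bigr)\partial+18(a_1h_2''-a_2h_1'')\partial^2+\bigl(12(a_1h_2'-a_2h_1')+2\omega(h_1,h_2)\bigr)\partial^3-h_1'''\omega(h_2)+h_2'''\omega(h_1),$$ $$A_{12}=2(h_1'''h_2'-h_1'h_2''')+2(h_1h_2^{(4)}-h_1^{(4)}h_2)+(a_1h_2^{(6)}-a_2h_1^{(6)}),$$ $$A_{21}=\omega(h_2)(4h_1'+2h_1\partial+a_1\partial^3)-\omega(h_1)(4h_2'+2h_2\partial+a_2\partial^3).$$ 2. Equivalently (Misiolek's formula), $4\mathcal R((h_1,a_1),(h_2,a_2))(h_3,a_3)$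 has first component $$4(h_1h_2''-h_1''h_2)h_3+2(a_1h_2^{(4)}-a_2h_1^{(4)})h_3+\bigl(8(h_1h_2'-h_1'h_2)+10(a_1h_2'''-a_2h_1''')\bigr)h_3'+18(a_1h_2''-a_2h_1'')h_3''+12(a_1h_2'-a_2h_1')h_3'''$$ $$+2h_3'''\int_{S^1}h_1'h_2''dx-h_1'''\int_{S^1}h_2'h_3''dx+h_2'''\int_{S^1}h_1'h_3''dx+2a_3(h_1'''h_2'-h_1'h_2''')+2a_3(h_1h_2^{(4)}-h_1^{(4)}h_2)+a_3(a_1h_2^{(6)}-a_2h_1^{(6)})$$ and second component $$\int_{S^1}h_3'''(a_1h_2'''-a_2h_1''')\,dx+\int_{S^1}2h_3'(h_1h_2'''-h_1'''h_2-2h_1'h_2''+2h_1''h_2')\,dx.$$ 3. With $[h_1,h_2]=h_1'h_2-h_1h_2'$, the sectional curvature quantity $\langle4\mathcal R((h_1,a_1),(h_2,a_2))(h_1,a_1),(h_2,a_2)\rangle$ equals $$\int_{S^1}\Bigl(-4[h_1,h_2]^2+4(a_1h_2-a_2h_1)(h_1h_2^{(4)}-h_1'h_2'''+h_1'''h_2'-h_1^{(4)}h_2)-(h_2''')^2a_1^2+2h_1'''h_2'''a_1a_2-(h_1''')^2a_2^2\Bigr)dx+3\,\omega(h_1,h_2)^2.$$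 4. For $h_1=\sin$, $h_2=\cos$ this quantity is $-\pi(8+a_1^2+a_2^2-3\pi)$. It is positive for some $(a_1,a_2)$ and negative for others, so its sign is not constant. -/

import Mathlib

open Real
open scoped ContDiff

noncomputable section

namespace VirasoroBott

/-! ## The Virasoro-Bott group -/

/-- The space `C^∞(S¹, ℝ)` (equivalently, of smooth vector fields on `S¹`), where `S¹ = ℝ/2πℤ`:
smooth `2π`-periodic functions on the line. -/
def SmoothPer : Submodule ℝ (ℝ → ℝ) where
  carrier := {h | ContDiff ℝ ∞ h ∧ Function.Periodic h (2 * π)}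
  add_mem' := fun ha hb => ⟨ha.1.add hb.1, ha.2.add hb.2⟩
  zero_mem' := ⟨contDiff_const, fun _ => rfl⟩
  smul_mem' := fun c _ ha => ⟨contDiff_const.smul ha.1, fun x => by
    simp only [Pi.smul_apply, ha.2 x]⟩

/-- `f : ℝ → ℝ` is a lift of an orientation preserving diffeomorphism of `S¹ = ℝ/2πℤ`. -/
def IsLift (f : ℝ → ℝ) : Prop :=
  ContDiff ℝ ∞ f ∧ (∀ x, f (x + 2 * π) = f x + 2 * π) ∧ ∀ x, 0 < deriv f x

/-- The Bott cocycle `c(φ, ψ) = ∫_{S¹} log (φ ∘ ψ)' d log ψ'`, in terms of lifts. -/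
def bott (f g : ℝ → ℝ) : ℝ :=
  ∫ x in (0 : ℝ)..(2 * π), log (deriv (f ∘ g) x) * deriv (fun y => log (deriv g y)) x

/-- The group `Diff⁺(S¹)`: maps of the circle that have a lift as above. -/
@[ext] structure CircleDiffeo where
  toFun : AddCircle (2 * π) → AddCircle (2 * π)
  exists_lift : ∃ f : ℝ → ℝ, IsLift f ∧ ∀ x : ℝ, toFun (x : AddCircle (2 * π)) = (f x : ℝ)

theorem IsLift.comp {f g : ℝ → ℝ} (hf : IsLift f) (hg : IsLift g) : IsLift (f ∘ g) := by
  refine ⟨hf.1.comp hg.1, fun x => ?_, fun x => ?_⟩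
  · simp only [Function.comp_apply, hg.2.1, hf.2.1]
  · rw [deriv_comp x (hf.1.differentiable (by simp) _) (hg.1.differentiable (by simp) _)]
    exact mul_pos (hf.2.2 _) (hg.2.2 _)

/-- A lift of a diffeomorphism; it is unique up to a constant in `2πℤ`. -/
def CircleDiffeo.lift (φ : CircleDiffeo) : ℝ → ℝ := φ.exists_lift.choose

theorem CircleDiffeo.isLift_lift (φ : CircleDiffeo) : IsLift φ.lift :=
  φ.exists_lift.choose_spec.1

theorem CircleDiffeo.apply_coe (φ : CircleDiffeo) (x : ℝ) :
    φ.toFun (x : AddCircle (2 * π)) = (φ.lift x : ℝ) :=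
  φ.exists_lift.choose_spec.2 x

/-- Composition in `Diff⁺(S¹)`. -/
def CircleDiffeo.comp (φ ψ : CircleDiffeo) : CircleDiffeo where
  toFun := φ.toFun ∘ ψ.toFun
  exists_lift := ⟨φ.lift ∘ ψ.lift, φ.isLift_lift.comp ψ.isLift_lift, fun x => by
    simp only [Function.comp_apply, ψ.apply_coe, φ.apply_coe]⟩

/-- The Virasoro-Bott group `S¹ ×_c Diff⁺(S¹)`; the component in `Diff⁺(S¹)` is written first. -/
@[ext] structure VBGroup where
  diffeo : CircleDiffeo
  phase : Circle

/-- `(φ, α)(ψ, β) = (φ ∘ ψ, α β e^{2πi c(φ, ψ)})`. -/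
instance : Mul VBGroup where
  mul g k := ⟨g.diffeo.comp k.diffeo,
    g.phase * k.phase * Circle.exp (2 * π * bott g.diffeo.lift k.diffeo.lift)⟩

/-! ### Coordinates

The group is described in the coordinates `(f, τ) ↦ ([f], e^{4πiτ})`, with `f` a lift of a
diffeomorphism and `τ` real. They range over an open convex subset of an affine space modelled on
`C^∞(S¹, ℝ) × ℝ`, cover the whole group, and are unique up to `f ↦ f + 2πm`, `τ ↦ τ + n/2`, so that
they restrict to charts on small open sets. The scale `4π` is the identification of the Lie algebra
of the central `S¹` with `ℝ` for which the bracket of the Lie algebra of the group is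
`[(h, a), (k, b)] = (h'k - hk', ∫ h'k'' dx)`. -/

/-- Pairs `(f, τ)`: coordinates of points, and components of tangent vectors. -/
abbrev Coord := (ℝ → ℝ) × ℝ

/-- The coordinates of points of the group. -/
def points : Set Coord := {p | IsLift p.1}

/-- The point of the Virasoro-Bott group with given coordinates. -/
def toGroup (p : Coord) (hp : p ∈ points) : VBGroup where
  diffeo :=
    { toFun := Function.Periodic.lift (f := fun y : ℝ => ((p.1 y : ℝ) : AddCircle (2 * π)))
        (c := 2 * π) (fun y => by simp only [hp.2.1 y, AddCircle.coe_add_period])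
      exists_lift := ⟨p.1, hp, fun _ => rfl⟩ }
  phase := Circle.exp (4 * π * p.2)

/-- The multiplication of the Virasoro-Bott group in coordinates. -/
def cmul (p q : Coord) : Coord := (p.1 ∘ q.1, p.2 + q.2 + bott p.1 q.1 / 2)

theorem cmul_mem {p q : Coord} (hp : p ∈ points) (hq : q ∈ points) : cmul p q ∈ points :=
  show IsLift (p.1 ∘ q.1) from IsLift.comp (show IsLift p.1 from hp) (show IsLift q.1 from hq)

/-- The inverse of the Virasoro-Bott group in coordinates (note that `c(φ, φ⁻¹) = 0`). -/
def cinv (p : Coord) : Coord := (Function.invFun p.1, -p.2)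

/-- All points of the group have coordinates. -/
theorem exists_toGroup_eq (g : VBGroup) : ∃ p, ∃ hp : p ∈ points, toGroup p hp = g := by
  obtain ⟨t, ht⟩ := Circle.exp_surjective g.phase
  refine ⟨(g.diffeo.lift, t / (4 * π)), g.diffeo.isLift_lift, ?_⟩
  ext x
  · obtain ⟨y, rfl⟩ := QuotientAddGroup.mk_surjective x
    exact (g.diffeo.apply_coe y).symm
  · have h : 4 * π * (t / (4 * π)) = t := by field_simp
    simp only [toGroup, h, ht]

/-- Two lifts of the same diffeomorphism differ by a constant in `2πℤ`. -/
theorem eq_add_of_coe_eq {f g : ℝ → ℝ} (hf : Continuous f) (hg : Continuous g)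
    (h : ∀ x, ((f x : ℝ) : AddCircle (2 * π)) = (g x : ℝ)) :
    ∃ n : ℤ, ∀ x, f x = g x + n * (2 * π) := by
  have h' : ∀ x, ∃ n : ℤ, n • (2 * π) = f x - g x := fun x => by
    rw [← AddCircle.coe_eq_zero_iff, AddCircle.coe_sub, h x, sub_self]
  choose n hn using h'
  have hpi : (2 * π) ≠ 0 := two_pi_pos.ne'
  have hc : Continuous n := by
    rw [Int.isClosedEmbedding_coe_real.isInducing.continuous_iff]
    have : ((fun m : ℤ => (m : ℝ)) ∘ n) = fun x => (f x - g x) / (2 * π) := by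
      funext x
      rw [← hn x]
      simp only [Function.comp_apply, zsmul_eq_mul]
      field_simp
    rw [this]
    fun_prop
  refine ⟨n 0, fun x => ?_⟩
  have h0 : n x = n 0 := PreconnectedSpace.constant inferInstance hc
  have := hn x
  rw [h0, zsmul_eq_mul] at this
  linarith

/-- In coordinates, the multiplication of the group is `cmul`. -/
theorem toGroup_cmul (p q : Coord) (hp : p ∈ points) (hq : q ∈ points) :
    toGroup (cmul p q) (cmul_mem hp hq) = toGroup p hp * toGroup q hq := by
  obtain ⟨m, hm⟩ := eq_add_of_coe_eq (toGroup p hp).diffeo.isLift_lift.1.continuous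
    hp.1.continuous (fun x => ((toGroup p hp).diffeo.apply_coe x).symm)
  obtain ⟨n, hn⟩ := eq_add_of_coe_eq (toGroup q hq).diffeo.isLift_lift.1.continuous
    hq.1.continuous (fun x => ((toGroup q hq).diffeo.apply_coe x).symm)
  have hper : ∀ y, p.1 (y + n * (2 * π)) = p.1 y + n * (2 * π) := by
    have hP : Function.Periodic (fun y => p.1 y - y) (2 * π) := fun y => by
      simp only [hp.2.1 y]; ring
    intro y
    have := hP.int_mul n y
    linarith
  have hd : deriv (toGroup q hq).diffeo.lift = deriv q.1 := by
    rw [funext hn]; funext x; rw [deriv_add_const]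
  have hcomp : (toGroup p hp).diffeo.lift ∘ (toGroup q hq).diffeo.lift =
      fun x => (p.1 ∘ q.1) x + (n * (2 * π) + m * (2 * π)) := by
    funext x
    simp only [Function.comp_apply, hm, hn, hper]; ring
  have hb : bott (toGroup p hp).diffeo.lift (toGroup q hq).diffeo.lift = bott p.1 q.1 := by
    unfold bott
    rw [hd, hcomp]
    simp only [deriv_add_const]
  apply VBGroup.ext
  · apply CircleDiffeo.ext
    funext x
    obtain ⟨y, rfl⟩ := QuotientAddGroup.mk_surjective x
    rfl
  · change Circle.exp _ = Circle.exp _ * Circle.exp _ * Circle.exp (2 * π * bott _ _)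
    rw [hb, ← Circle.exp_add, ← Circle.exp_add]
    congr 1
    simp only [cmul]
    ring

/-! ## The right invariant `L²` metric -/

/-- The Lie algebra `X(S¹) ⊕ ℝ` of the group; its elements are written `(h, a)`. -/
abbrev Vir := SmoothPer × ℝ

/-- The velocity at `t = 0` of a curve in coordinates. -/
def velocity (c : ℝ → Coord) : Coord :=
  (fun x => deriv (fun t => (c t).1 x) 0, deriv (fun t => (c t).2) 0)

/-- The right invariant vector field `R_X`: its value at `p` is `T_e(μ^p) X`, where `μ^p` is the
right translation by `p`. -/
def rightField (X : Vir) (p : Coord) : Coord :=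
  velocity fun t => cmul (fun x => x + t * X.1.1 x, t * X.2) p

/-- The right trivialisation `T_p(μ^{p⁻¹}) v` of a tangent vector `v` at `p`. -/
def rightTriv (p v : Coord) : Coord :=
  velocity fun t => cmul (p + t • v) (cinv p)

/-- The `L²` inner product `∫ h k dx + a b`. -/
def innerL2 (v w : Coord) : ℝ := (∫ x in (0 : ℝ)..(2 * π), v.1 x * w.1 x) + v.2 * w.2

/-- The right invariant weak Riemannian metric given by the `L²` inner product at the identity. -/
def metric (p v w : Coord) : ℝ := innerL2 (rightTriv p v) (rightTriv p w)

/-! ## The Levi-Civita connection and the curvature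

A vector field is a map `V : Coord → Coord`, of which only the values at points of the group
matter. -/

/-- The derivative of the function `F` along the vector field `V`. -/
def dirDeriv (V : Coord → Coord) (F : Coord → ℝ) (p : Coord) : ℝ :=
  deriv (fun t : ℝ => F (p + t • V p)) 0

/-- The Lie bracket `[V, W] = dW(V) - dV(W)` of vector fields. -/
def lieBracket (V W : Coord → Coord) (p : Coord) : Coord :=
  velocity (fun t => W (p + t • V p)) - velocity (fun t => V (p + t • W p))

/-- `U = ∇_V W` for the Levi-Civita connection of the metric: `U` is tangent to the group and
satisfies the Koszul formula. Since that formula is tensorial in the third vector field and every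
tangent vector is a value of a right invariant field, it is enough to impose it for the latter. -/
def IsCovDeriv (V W U : Coord → Coord) : Prop :=
  ∀ p ∈ points, (U p).1 ∈ SmoothPer ∧ ∀ X : Vir, let Z := rightField X
    2 * metric p (U p) (Z p) =
      dirDeriv V (fun q => metric q (W q) (Z q)) p
      + dirDeriv W (fun q => metric q (V q) (Z q)) p
      - dirDeriv Z (fun q => metric q (V q) (W q)) p
      + metric p (lieBracket V W p) (Z p)
      - metric p (lieBracket V Z p) (W p)
      - metric p (lieBracket W Z p) (V p)

/-- `C = 𝓡(V, W)U = ∇_V ∇_W U - ∇_W ∇_V U - ∇_{[V, W]} U`. -/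
def IsCurvature (V W U C : Coord → Coord) : Prop :=
  ∃ A B A' B' D : Coord → Coord,
    IsCovDeriv W U A ∧ IsCovDeriv V A A' ∧ IsCovDeriv V U B ∧ IsCovDeriv W B B' ∧
    IsCovDeriv (lieBracket V W) U D ∧ ∀ p ∈ points, C p = A' p - B' p - D p

/-! ## The entries of the curvature operator -/

/-- The Gelfand-Fuchs cocycle `ω(h, k) = ∫ h'k'' dx`. -/
def gf (h k : ℝ → ℝ) : ℝ := ∫ x in (0 : ℝ)..(2 * π), deriv h x * iteratedDeriv 2 k x


/-- The upper left entry of the matrix of `4𝓡((h₁, a₁), (h₂, a₂))`. -/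
def entry11 (h₁ : ℝ → ℝ) (a₁ : ℝ) (h₂ : ℝ → ℝ) (a₂ : ℝ) (l : ℝ → ℝ) (x : ℝ) : ℝ :=
  (4 * (h₁ x * iteratedDeriv 2 h₂ x - iteratedDeriv 2 h₁ x * h₂ x)
      + 2 * (a₁ * iteratedDeriv 4 h₂ x - a₂ * iteratedDeriv 4 h₁ x)) * l x
    + (8 * (h₁ x * deriv h₂ x - deriv h₁ x * h₂ x)
      + 10 * (a₁ * iteratedDeriv 3 h₂ x - a₂ * iteratedDeriv 3 h₁ x)) * deriv l x
    + 18 * (a₁ * iteratedDeriv 2 h₂ x - a₂ * iteratedDeriv 2 h₁ x) * iteratedDeriv 2 l x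
    + (12 * (a₁ * deriv h₂ x - a₂ * deriv h₁ x) + 2 * gf h₁ h₂) * iteratedDeriv 3 l x
    - iteratedDeriv 3 h₁ x * gf h₂ l + iteratedDeriv 3 h₂ x * gf h₁ l

/-- The upper right entry (a multiplication operator on constants). -/
def entry12 (h₁ : ℝ → ℝ) (a₁ : ℝ) (h₂ : ℝ → ℝ) (a₂ : ℝ) (x : ℝ) : ℝ :=
  2 * (iteratedDeriv 3 h₁ x * deriv h₂ x - deriv h₁ x * iteratedDeriv 3 h₂ x)
    + 2 * (h₁ x * iteratedDeriv 4 h₂ x - iteratedDeriv 4 h₁ x * h₂ x)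
    + (a₁ * iteratedDeriv 6 h₂ x - a₂ * iteratedDeriv 6 h₁ x)

/-- The lower left entry. -/
def entry21 (h₁ : ℝ → ℝ) (a₁ : ℝ) (h₂ : ℝ → ℝ) (a₂ : ℝ) (l : ℝ → ℝ) : ℝ :=
  gf h₂ (fun x => 4 * deriv h₁ x * l x + 2 * h₁ x * deriv l x + a₁ * iteratedDeriv 3 l x)
    - gf h₁ (fun x => 4 * deriv h₂ x * l x + 2 * h₂ x * deriv l x + a₂ * iteratedDeriv 3 l x)

/-- The function `sin` as an element of `C^∞(S¹, ℝ)`. -/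
def sinP : SmoothPer := ⟨Real.sin, Real.contDiff_sin, Real.sin_periodic⟩

/-- The function `cos` as an element of `C^∞(S¹, ℝ)`. -/
def cosP : SmoothPer := ⟨Real.cos, Real.contDiff_cos, Real.cos_periodic⟩

end VirasoroBott

end

open VirasoroBott

/-!
In the coordinates `(f, τ)` the right invariant field of `(h, a)` is
`(f, τ) ↦ (h ∘ f, a + ½ ∫ h'(f) d log f')` (`rightField_eq`): the central component is the
derivative of the Bott cocycle. Every tangent vector is a value of such a field, the inner product
of two of them is constant (`metric_invField`), and the bracket of two of them is the right
invariant field of the opposite of the Lie algebra bracket (`lieBracket_eq`). The last fact needs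
the derivative of `½ ∫ k'(f) d log f'` along the field of `h`; its part antisymmetric in `h` and `k`
produces the Gelfand-Fuchs cocycle after the change of variables `x = f(y)`.

Hence in the Koszul formula for right invariant fields the three derivatives of inner products
vanish and the remaining terms are inner products in the Lie algebra. As the inner product is
nondegenerate, the formula has exactly one solution: the right invariant field of
`½ (2h'k + 4hk' + bh''' + ak''', -ω(h, k))` (`isCovDeriv_iff`). Being right invariant again, it can
be differentiated once more, so that the curvature exists, is unique and is given by the purely
algebraic expression `algCurv` (`isCurvature_iff`).

What remains is algebra: it takes place over an arbitrary commutative algebra `A` with a derivation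
`d` and a linear functional `I` that vanishes on derivatives. The upper row of the curvature is a
direct computation; the lower row and the sectional curvature hold after integration by parts, and
in each case one exhibits an element of `A` whose derivative is the difference of the integrands
(`map_eq_of_sub_eq_deriv`).
-/

namespace VirasoroBott

open Filter Topology MeasureTheory

/-! ### The connection and its curvature over an algebra with a derivation -/

section Algebra

variable {A : Type*} [CommRing A] [Algebra ℝ A] (d : Derivation ℝ A A) (I : A →ₗ[ℝ] ℝ)

/-- The cocycle `I(h'k'')`. -/
def algCocycle (h k : A) : ℝ := I (d h * d (d k))

/-- The inner product `I(hk) + ab` on `A × ℝ`. -/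
def algInner (X Y : A × ℝ) : ℝ := I (X.1 * Y.1) + X.2 * Y.2

/-- The bracket `[(h, a), (k, b)] = (h'k - hk', I(h'k''))` on `A × ℝ`. -/
def algBracket (X Y : A × ℝ) : A × ℝ := (d X.1 * Y.1 - X.1 * d Y.1, algCocycle d I X.1 Y.1)

/-- Twice the Levi-Civita connection on right invariant fields:
`2∇_{(h, a)}(k, b) = (2h'k + 4hk' + bh''' + ak''', -I(h'k''))`. -/
noncomputable def algTwoNabla (X Y : A × ℝ) : A × ℝ :=
  ((2 : ℝ) • (d X.1 * Y.1) + (4 : ℝ) • (X.1 * d Y.1) + Y.2 • d (d (d X.1))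
    + X.2 • d (d (d Y.1)), -algCocycle d I X.1 Y.1)

/-- The Levi-Civita connection on right invariant fields. -/
noncomputable def algNabla (X Y : A × ℝ) : A × ℝ := (1 / 2 : ℝ) • algTwoNabla d I X Y

/-- The curvature on right invariant fields. The sign in the last term reflects that the bracket
of right invariant fields is the opposite of `algBracket`. -/
noncomputable def algCurv (X Y Z : A × ℝ) : A × ℝ :=
  algNabla d I X (algNabla d I Y Z) - algNabla d I Y (algNabla d I X Z)
    - algNabla d I (-algBracket d I X Y) Z

variable {d I}

/-- Integration by parts in the form used throughout: integrands that differ by a derivative have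
the same integral. -/
theorem map_eq_of_sub_eq_deriv (hI : ∀ x, I (d x) = 0) {x y : A} (P : A) (h : x - y = d P) :
    I x = I y := by
  rw [← sub_eq_zero, ← map_sub, h, hI]

theorem mul_map_eq (r : ℝ) (x : A) : r * I x = I (algebraMap ℝ A r * x) := by
  rw [← Algebra.smul_def, map_smul, smul_eq_mul]

theorem algCocycle_antisymm (hI : ∀ x, I (d x) = 0) (h k : A) :
    algCocycle d I h k = -algCocycle d I k h := by
  rw [algCocycle, algCocycle, ← map_neg]
  refine map_eq_of_sub_eq_deriv hI (d h * d k) ?_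
  simp only [Derivation.leibniz, smul_eq_mul]
  ring

theorem algTwoNabla_smul (r : ℝ) (X Y : A × ℝ) :
    algTwoNabla d I X (r • Y) = r • algTwoNabla d I X Y := by
  ext
  · simp only [algTwoNabla, Prod.smul_fst, Prod.smul_snd, Derivation.map_smul, smul_eq_mul]
    simp only [Algebra.smul_def, map_mul]
    ring
  · simp only [algTwoNabla, algCocycle, Prod.smul_fst, Prod.smul_snd, Derivation.map_smul,
      mul_smul_comm, map_smul, smul_neg]

theorem algTwoNabla_neg (X Y : A × ℝ) : algTwoNabla d I (-X) Y = -algTwoNabla d I X Y := by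
  ext
  · simp only [algTwoNabla, Prod.fst_neg, Prod.snd_neg, map_neg]
    simp only [Algebra.smul_def, map_neg]
    ring
  · simp only [algTwoNabla, algCocycle, Prod.fst_neg, Prod.snd_neg, map_neg, neg_mul]

/-- The curvature without denominators. -/
theorem four_smul_algCurv (X Y Z : A × ℝ) :
    (4 : ℝ) • algCurv d I X Y Z =
      algTwoNabla d I X (algTwoNabla d I Y Z) - algTwoNabla d I Y (algTwoNabla d I X Z)
        + (2 : ℝ) • algTwoNabla d I (algBracket d I X Y) Z := by
  simp only [algCurv, algNabla, algTwoNabla_smul, algTwoNabla_neg]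
  module

/-- The Koszul formula for right invariant fields. -/
theorem two_mul_algInner_algNabla (hI : ∀ x, I (d x) = 0) (X Y Z : A × ℝ) :
    2 * algInner I (algNabla d I X Y) Z =
      algInner I (-algBracket d I X Y) Z - algInner I (-algBracket d I X Z) Y
        - algInner I (-algBracket d I Y Z) X := by
  obtain ⟨h, a⟩ := X
  obtain ⟨k, b⟩ := Y
  obtain ⟨l, c⟩ := Z
  have key : I (((2 : ℝ) • (d h * k) + (4 : ℝ) • (h * d k) + b • d (d (d h))
        + a • d (d (d k))) * l) =
      I (-(d h * k - h * d k) * l) + I ((d h * l - h * d l) * k) + I ((d k * l - k * d l) * h)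
        + b * I (d h * d (d l)) + a * I (d k * d (d l)) := by
    simp only [mul_map_eq, ← map_add]
    refine map_eq_of_sub_eq_deriv hI ((2 : ℝ) • (h * k * l)
      + b • (d (d h) * l - d h * d l) + a • (d (d k) * l - d k * d l)) ?_
    simp only [map_add, map_sub, Derivation.map_smul, Derivation.leibniz, smul_eq_mul]
    simp only [Algebra.smul_def, map_ofNat]
    ring
  simp only [algInner, algNabla, algTwoNabla, algBracket, algCocycle, Prod.smul_fst,
    Prod.smul_snd, Prod.fst_neg, Prod.snd_neg, smul_mul_assoc, map_smul, smul_eq_mul, neg_mul,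
    map_neg] at key ⊢
  linear_combination key

/-- The upper row of the curvature operator. -/
theorem four_smul_algCurv_fst (h₁ h₂ h₃ : A) (a₁ a₂ a₃ : ℝ) :
    ((4 : ℝ) • algCurv d I (h₁, a₁) (h₂, a₂) (h₃, a₃)).1 =
      ((4 : ℝ) • (h₁ * d (d h₂) - d (d h₁) * h₂)
        + (2 : ℝ) • (a₁ • d (d (d (d h₂))) - a₂ • d (d (d (d h₁))))) * h₃
      + ((8 : ℝ) • (h₁ * d h₂ - d h₁ * h₂)
        + (10 : ℝ) • (a₁ • d (d (d h₂)) - a₂ • d (d (d h₁)))) * d h₃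
      + (18 : ℝ) • ((a₁ • d (d h₂) - a₂ • d (d h₁)) * d (d h₃))
      + (12 : ℝ) • ((a₁ • d h₂ - a₂ • d h₁) * d (d (d h₃)))
      + (2 * algCocycle d I h₁ h₂) • d (d (d h₃))
      - algCocycle d I h₂ h₃ • d (d (d h₁)) + algCocycle d I h₁ h₃ • d (d (d h₂))
      + a₃ • ((2 : ℝ) • (d (d (d h₁)) * d h₂ - d h₁ * d (d (d h₂)))
        + (2 : ℝ) • (h₁ * d (d (d (d h₂))) - d (d (d (d h₁))) * h₂)
        + (a₁ • d (d (d (d (d (d h₂))))) - a₂ • d (d (d (d (d (d h₁))))))) := by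
  rw [four_smul_algCurv]
  simp only [algTwoNabla, algBracket, Prod.smul_fst, Prod.fst_sub, Prod.fst_add, map_add, map_sub,
    Derivation.map_smul, Derivation.leibniz, smul_eq_mul]
  simp only [Algebra.smul_def, map_neg, map_mul, map_ofNat]
  ring

/-- The lower row of the curvature operator. -/
theorem four_smul_algCurv_snd (hI : ∀ x, I (d x) = 0) (h₁ h₂ h₃ : A) (a₁ a₂ a₃ : ℝ) :
    ((4 : ℝ) • algCurv d I (h₁, a₁) (h₂, a₂) (h₃, a₃)).2 =
      algCocycle d I h₂ ((4 : ℝ) • (d h₁ * h₃) + (2 : ℝ) • (h₁ * d h₃) + a₁ • d (d (d h₃)))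
      - algCocycle d I h₁
        ((4 : ℝ) • (d h₂ * h₃) + (2 : ℝ) • (h₂ * d h₃) + a₂ • d (d (d h₃))) := by
  rw [four_smul_algCurv]
  simp only [algTwoNabla, algBracket, algCocycle, Prod.smul_snd, Prod.snd_sub, Prod.snd_add,
    smul_eq_mul, ← map_neg, ← map_sub, ← map_add, mul_map_eq]
  -- Two derivatives are moved off `h₂'h₃ - h₂h₃'` and `h₁'h₃ - h₁h₃'`, and one off `h₃''`; the
  -- remainder is the derivative of `(h₁''h₂' - h₁'h₂'')h₃`.
  refine map_eq_of_sub_eq_deriv hI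
    ((2 : ℝ) • (d h₁ * d (d h₂ * h₃ - h₂ * d h₃) - d (d h₁) * (d h₂ * h₃ - h₂ * d h₃)
        - d h₂ * d (d h₁ * h₃ - h₁ * d h₃) + d (d h₂) * (d h₁ * h₃ - h₁ * d h₃)
        - (d (d h₁) * h₂ - h₁ * d (d h₂)) * d h₃
        + (d (d h₁) * d h₂ - d h₁ * d (d h₂)) * h₃)
      + a₃ • (d (d (d (d h₁))) * d h₂ - d (d (d h₁)) * d (d h₂) + d (d h₁) * d (d (d h₂))
        - d h₁ * d (d (d (d h₂))))) ?_
  simp only [map_add, map_sub, Derivation.map_smul, Derivation.leibniz, smul_eq_mul]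
  simp only [Algebra.smul_def, map_ofNat]
  ring

/-- The lower row of the curvature operator, after integration by parts. -/
theorem four_smul_algCurv_snd' (hI : ∀ x, I (d x) = 0) (h₁ h₂ h₃ : A) (a₁ a₂ a₃ : ℝ) :
    ((4 : ℝ) • algCurv d I (h₁, a₁) (h₂, a₂) (h₃, a₃)).2 =
      I (d (d (d h₃)) * (a₁ • d (d (d h₂)) - a₂ • d (d (d h₁))))
      + I ((2 : ℝ) • (d h₃ * (h₁ * d (d (d h₂)) - d (d (d h₁)) * h₂
        - (2 : ℝ) • (d h₁ * d (d h₂)) + (2 : ℝ) • (d (d h₁) * d h₂)))) := by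
  rw [four_smul_algCurv_snd hI]
  simp only [algCocycle, ← map_sub, ← map_add]
  -- Two derivatives are moved off the second arguments of the cocycles; the remainder is the
  -- derivative of `4(h₁'h₂'' - h₁''h₂')h₃`.
  refine map_eq_of_sub_eq_deriv hI
    (d h₂ * d ((4 : ℝ) • (d h₁ * h₃) + (2 : ℝ) • (h₁ * d h₃) + a₁ • d (d (d h₃)))
      - d (d h₂) * ((4 : ℝ) • (d h₁ * h₃) + (2 : ℝ) • (h₁ * d h₃) + a₁ • d (d (d h₃)))
      - d h₁ * d ((4 : ℝ) • (d h₂ * h₃) + (2 : ℝ) • (h₂ * d h₃) + a₂ • d (d (d h₃)))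
      + d (d h₁) * ((4 : ℝ) • (d h₂ * h₃) + (2 : ℝ) • (h₂ * d h₃) + a₂ • d (d (d h₃)))
      + (4 : ℝ) • ((d h₁ * d (d h₂) - d (d h₁) * d h₂) * h₃)) ?_
  simp only [map_add, map_sub, Derivation.map_smul, Derivation.leibniz, smul_eq_mul]
  simp only [Algebra.smul_def, map_ofNat]
  ring

/-- The sectional curvature quantity `⟨4R(X₁, X₂)X₁, X₂⟩`. -/
theorem algInner_four_smul_algCurv (hI : ∀ x, I (d x) = 0) (h₁ h₂ : A) (a₁ a₂ : ℝ) :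
    algInner I ((4 : ℝ) • algCurv d I (h₁, a₁) (h₂, a₂) (h₁, a₁)) (h₂, a₂) =
      I ((-4 : ℝ) • (d h₁ * h₂ - h₁ * d h₂) ^ 2
        + (4 : ℝ) • ((a₁ • h₂ - a₂ • h₁) * (h₁ * d (d (d (d h₂))) - d h₁ * d (d (d h₂))
          + d (d (d h₁)) * d h₂ - d (d (d (d h₁))) * h₂))
        - a₁ ^ 2 • (d (d (d h₂))) ^ 2 + (2 * a₁ * a₂) • (d (d (d h₁)) * d (d (d h₂)))
        - a₂ ^ 2 • (d (d (d h₁))) ^ 2) + 3 * algCocycle d I h₁ h₂ ^ 2 := by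
  -- Products of two integrals occur with the factors `2` from `2ω(h₁, h₂)h₁'''`, `1` from
  -- `-ω(h₂, h₁)h₁'''` and `0` from `ω(h₁, h₁)h₂'''`, and `∫ h₁'''h₂ = ω(h₁, h₂)`.
  have h11 : algCocycle d I h₁ h₁ = 0 := by linarith [algCocycle_antisymm hI h₁ h₁]
  rw [algInner, four_smul_algCurv_fst, four_smul_algCurv_snd' hI, h11,
    algCocycle_antisymm hI h₂ h₁]
  have hw : 3 * algCocycle d I h₁ h₂ ^ 2 = I ((3 * algCocycle d I h₁ h₂) • (d h₁ * d (d h₂))) := by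
    rw [map_smul, smul_eq_mul, algCocycle]
    ring
  rw [hw, ← map_add, mul_comm _ a₂, mul_map_eq, ← map_add, ← map_add]
  generalize algCocycle d I h₁ h₂ = w
  -- A primitive, ordered by the monomials in `a₁`, `a₂` and `w`. In the parts linear in `a₁` and
  -- `a₂` it is found by moving all derivatives off `h₁` and `h₂` respectively.
  refine map_eq_of_sub_eq_deriv hI ((4 : ℝ) • ((h₁ * d h₂ - d h₁ * h₂) * h₁ * h₂)
    + a₁ • ((2 : ℝ) • (d (d (d h₁)) * h₂ ^ 2) + (6 : ℝ) • (d (d h₁) * h₂ * d h₂)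
      + (6 : ℝ) • (d h₁ * ((2 : ℝ) • (h₂ * d (d h₂)) - d h₂ * d h₂)))
    + a₂ • ((4 : ℝ) • (h₁ ^ 2 * d (d (d h₂))) - (10 : ℝ) • (h₁ * d h₁ * d (d h₂))
      + ((6 : ℝ) • (d h₁ * d h₁) + (10 : ℝ) • (h₁ * d (d h₁))) * d h₂
      - ((18 : ℝ) • (d h₁ * d (d h₁)) + (6 : ℝ) • (h₁ * d (d (d h₁)))) * h₂)
    + a₁ ^ 2 • (d (d (d (d (d h₂)))) * h₂ - d (d (d (d h₂))) * d h₂ + d (d (d h₂)) * d (d h₂))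
    - (a₁ * a₂) • (d (d (d (d (d h₁)))) * h₂ - d (d (d (d h₁))) * d h₂
      + d (d (d h₁)) * d (d h₂))
    + (3 * w) • (d (d h₁) * h₂ - d h₁ * d h₂)) ?_
  simp only [map_add, map_sub, Derivation.map_smul, Derivation.leibniz, smul_eq_mul, pow_two]
  simp only [Algebra.smul_def, map_ofNat, map_neg, map_zero, map_mul]
  ring

end Algebra

/-! ### Smooth periodic functions and lifts of diffeomorphisms -/

/-- The algebra `C^∞(S¹, ℝ)`; its underlying submodule is `SmoothPer`. -/
def smoothPerAlg : Subalgebra ℝ (ℝ → ℝ) where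
  carrier := SmoothPer
  mul_mem' := fun ha hb => ⟨ha.1.mul hb.1, ha.2.mul hb.2⟩
  add_mem' := SmoothPer.add_mem
  algebraMap_mem' := fun _ => ⟨contDiff_const, fun _ => rfl⟩

theorem deriv_mem_smoothPer {h : ℝ → ℝ} (hh : h ∈ SmoothPer) : deriv h ∈ SmoothPer := by
  refine ⟨(contDiff_infty_iff_deriv.1 hh.1).2, fun x => ?_⟩
  rw [← deriv_comp_add_const, funext hh.2]

/-- The derivative `d/dx` on `C^∞(S¹, ℝ)`. -/
noncomputable def perDeriv : Derivation ℝ smoothPerAlg smoothPerAlg :=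
  Derivation.mk'
    { toFun := fun h => ⟨deriv h.1, deriv_mem_smoothPer h.2⟩
      map_add' := fun h k => Subtype.ext <| funext fun x =>
        deriv_add (h.2.1.differentiable (by simp) x) (k.2.1.differentiable (by simp) x)
      map_smul' := fun r h => Subtype.ext <| funext fun x =>
        deriv_const_smul r (h.2.1.differentiable (by simp) x) }
    fun h k => Subtype.ext <| funext fun x => by
      have := deriv_mul (h.2.1.differentiable (by simp) x) (k.2.1.differentiable (by simp) x)
      simp only [LinearMap.coe_mk, AddHom.coe_mk, smul_eq_mul, Subalgebra.coe_add,
        Subalgebra.coe_mul, Pi.add_apply, Pi.mul_apply] at this ⊢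
      rw [this]; ring

/-- The integral over `S¹`. -/
noncomputable def perInt : smoothPerAlg →ₗ[ℝ] ℝ where
  toFun h := ∫ x in (0 : ℝ)..(2 * π), h.1 x
  map_add' h k := intervalIntegral.integral_add (h.2.1.continuous.intervalIntegrable _ _)
    (k.2.1.continuous.intervalIntegrable _ _)
  map_smul' r _ := intervalIntegral.integral_smul r _

theorem perInt_perDeriv (h : smoothPerAlg) : perInt (perDeriv h) = 0 := by
  change ∫ x in (0 : ℝ)..(2 * π), deriv h.1 x = 0
  rw [intervalIntegral.integral_deriv_eq_sub (fun x _ => h.2.1.differentiable (by simp) x)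
    ((deriv_mem_smoothPer h.2).1.continuous.intervalIntegrable _ _)]
  have := h.2.2 0
  rw [zero_add] at this
  rw [this, sub_self]

/-- Elements of the Lie algebra `Vir`, as pairs with first entry in the algebra
`smoothPerAlg`. -/
def virEquiv : Vir ≃ₗ[ℝ] smoothPerAlg × ℝ where
  toFun X := (⟨X.1.1, X.1.2⟩, X.2)
  invFun X := (⟨X.1.1, X.1.2⟩, X.2)
  map_add' _ _ := rfl
  map_smul' _ _ := rfl
  left_inv _ := rfl
  right_inv _ := rfl

theorem exists_abs_le_of_mem_smoothPer {h : ℝ → ℝ} (hh : h ∈ SmoothPer) :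
    ∃ M, 0 < M ∧ ∀ x, |h x| ≤ M := by
  obtain ⟨C, hC⟩ := hh.2.compact_of_continuous two_pi_pos.ne' hh.1.continuous
    |>.exists_bound_of_continuousOn continuousOn_id
  refine ⟨max C 1, lt_max_of_lt_right one_pos, fun x => ?_⟩
  exact (hC _ ⟨x, rfl⟩).trans (le_max_left _ _)

section Lift

variable {f : ℝ → ℝ} (hf : IsLift f)
include hf

theorem IsLift.hasDerivAt (x : ℝ) : HasDerivAt f (deriv f x) x :=
  (hf.1.differentiable (by simp) x).hasDerivAt

theorem IsLift.deriv_mem : deriv f ∈ SmoothPer := by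
  refine ⟨(contDiff_infty_iff_deriv.1 hf.1).2, fun x => ?_⟩
  rw [← deriv_comp_add_const, funext hf.2.1, deriv_add_const]

theorem IsLift.comp_mem {h : ℝ → ℝ} (hh : h ∈ SmoothPer) : h ∘ f ∈ SmoothPer :=
  ⟨hh.1.comp hf.1, fun x => by simp only [Function.comp_apply, hf.2.1, hh.2 (f x)]⟩

theorem IsLift.log_deriv_mem : (fun y => log (deriv f y)) ∈ SmoothPer :=
  ⟨hf.deriv_mem.1.log fun x => (hf.2.2 x).ne', fun x => by simp only [hf.deriv_mem.2 x]⟩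

theorem IsLift.deriv_log_mem : deriv (fun y => log (deriv f y)) ∈ SmoothPer :=
  deriv_mem_smoothPer hf.log_deriv_mem

theorem IsLift.strictMono : StrictMono f := strictMono_of_deriv_pos hf.2.2

theorem IsLift.surjective : Function.Surjective f := by
  have hP : Function.Periodic (fun y => f y - y) (2 * π) := fun y => by
    simp only [hf.2.1 y]; ring
  have hn : ∀ n : ℤ, f (n * (2 * π)) = f 0 + n * (2 * π) := fun n => by
    have := hP.int_mul n 0
    simp only [zero_add] at this
    linarith
  intro y
  obtain ⟨n, hn1⟩ := exists_int_gt ((y - f 0) / (2 * π))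
  obtain ⟨m, hm1⟩ := exists_int_lt ((y - f 0) / (2 * π))
  rw [div_lt_iff₀ two_pi_pos] at hn1
  rw [lt_div_iff₀ two_pi_pos] at hm1
  exact mem_range_of_exists_le_of_exists_ge hf.1.continuous ⟨m * (2 * π), by rw [hn]; linarith⟩
    ⟨n * (2 * π), by rw [hn]; linarith⟩

theorem IsLift.apply_invFun (y : ℝ) : f (Function.invFun f y) = y :=
  Function.rightInverse_invFun hf.surjective y

theorem IsLift.invFun_apply (x : ℝ) : Function.invFun f (f x) = x :=
  Function.leftInverse_invFun hf.strictMono.injective x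

/-- The inverse of a lift is a lift. -/
theorem IsLift.invFun : IsLift (Function.invFun f) := by
  have hsm : ContDiff ℝ ∞ (Function.invFun f) := by
    let e : ℝ ≃ₜ ℝ := (hf.strictMono.orderIsoOfSurjective f hf.surjective).toHomeomorph
    have he : (e.symm : ℝ → ℝ) = Function.invFun f := by
      funext y
      apply hf.strictMono.injective
      rw [hf.apply_invFun]
      exact e.apply_symm_apply y
    rw [← he]
    exact e.contDiff_symm_deriv (fun x => (hf.2.2 x).ne') hf.hasDerivAt hf.1
  refine ⟨hsm, fun x => ?_, fun x => ?_⟩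
  · apply hf.strictMono.injective
    rw [hf.apply_invFun, hf.2.1, hf.apply_invFun]
  · have h1 := (hf.hasDerivAt (Function.invFun f x)).comp x
      (hsm.differentiable (by simp) x).hasDerivAt
    have h2 : f ∘ Function.invFun f = id := funext hf.apply_invFun
    rw [h2] at h1
    have h3 := h1.unique (hasDerivAt_id x)
    exact pos_of_mul_pos_right (h3 ▸ one_pos) (hf.2.2 _).le

/-- The change of variables `x = f y` in integrals over the circle. -/
theorem IsLift.integral_comp_mul_deriv {h : ℝ → ℝ} (hh : h ∈ SmoothPer) :
    ∫ y in (0 : ℝ)..(2 * π), h (f y) * deriv f y = ∫ x in (0 : ℝ)..(2 * π), h x := by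
  have h1 := intervalIntegral.integral_comp_mul_deriv (a := 0) (b := 2 * π)
    (fun x _ => hf.hasDerivAt x) hf.deriv_mem.1.continuous.continuousOn hh.1.continuous
  simp only [Function.comp_apply] at h1
  rw [h1]
  have h2 := hf.2.1 0
  rw [zero_add] at h2
  have h3 := hh.2.intervalIntegral_add_eq (f 0) 0
  rw [zero_add] at h3
  rw [h2, h3]

end Lift

/-! ### Differentiation under the integral sign -/

/-- Differentiation under the integral sign at `t = 0`, over a compact interval, when the
`t`-derivative of the integrand is jointly continuous. -/
theorem hasDerivAt_integral_of_continuousOn {F F' : ℝ → ℝ → ℝ} {a b δ : ℝ} (hδ : 0 < δ)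
    (hF : ∀ t, |t| < δ → Continuous (F t))
    (hF' : ContinuousOn (Function.uncurry F') (Metric.ball 0 δ ×ˢ Set.univ))
    (hd : ∀ t, |t| < δ → ∀ x, HasDerivAt (fun s => F s x) (F' t x) t) :
    HasDerivAt (fun t => ∫ x in a..b, F t x) (∫ x in a..b, F' 0 x) 0 := by
  have hsub : Metric.closedBall (0 : ℝ) (δ / 2) ×ˢ Set.uIcc a b ⊆
      Metric.ball 0 δ ×ˢ Set.univ :=
    Set.prod_mono (Metric.closedBall_subset_ball (by linarith)) (Set.subset_univ _)
  obtain ⟨C, hC⟩ := ((isCompact_closedBall (0 : ℝ) (δ / 2)).prod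
    isCompact_uIcc).exists_bound_of_continuousOn (hF'.mono hsub)
  have h0 : Continuous (F' 0) := by
    have : Continuous (fun x : ℝ => Function.uncurry F' (0, x)) :=
      hF'.comp_continuous (by fun_prop) fun x => ⟨Metric.mem_ball_self hδ, Set.mem_univ _⟩
    exact this
  refine (intervalIntegral.hasDerivAt_integral_of_dominated_loc_of_deriv_le
    (F' := F') (bound := fun _ => C) (Metric.closedBall_mem_nhds (0 : ℝ) (half_pos hδ))
    ?_ ((hF 0 (by simpa)).intervalIntegrable _ _) h0.aestronglyMeasurable
    (Eventually.of_forall fun x hx t ht => hC (t, x) ⟨ht, Set.uIoc_subset_uIcc hx⟩)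
    intervalIntegrable_const
    (Eventually.of_forall fun x _ t ht => hd t ?_ x)).2
  · filter_upwards [Metric.ball_mem_nhds (0 : ℝ) hδ] with t ht
    exact (hF t (by simpa using ht)).aestronglyMeasurable
  · have : |t| ≤ δ / 2 := by simpa using ht
    linarith

theorem one_add_mul_pos {M t u : ℝ} (hM : 0 < M) (hu : |u| ≤ M) (ht : |t| < 1 / M) :
    0 < 1 + t * u := by
  have h1 : |t * u| < 1 := by
    rw [abs_mul]
    calc |t| * |u| ≤ |t| * M := by gcongr
      _ < 1 / M * M := by gcongr
      _ = 1 := by field_simp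
  linarith [(abs_lt.1 h1).1]

/-- The derivative at `t = 0` of `∫ log(e^c (1 + t u)) g`. -/
theorem hasDerivAt_integral_log_mul {c u g : ℝ → ℝ} {M a b : ℝ} (hc : Continuous c)
    (hu : Continuous u) (hg : Continuous g) (hM : 0 < M) (huM : ∀ x, |u x| ≤ M) :
    HasDerivAt (fun t => ∫ x in a..b, (c x + log (1 + t * u x)) * g x)
      (∫ x in a..b, u x * g x) 0 := by
  have hpos : ∀ t, |t| < 1 / M → ∀ x, 0 < 1 + t * u x := fun t ht x =>
    one_add_mul_pos hM (huM x) ht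
  have key := hasDerivAt_integral_of_continuousOn (a := a) (b := b) (δ := 1 / M)
    (F := fun t x => (c x + log (1 + t * u x)) * g x)
    (F' := fun t x => u x / (1 + t * u x) * g x) (by positivity) ?_ ?_ ?_
  · simpa using key
  · intro t ht
    have : Continuous fun x => log (1 + t * u x) :=
      Continuous.log (by fun_prop) fun x => (hpos t ht x).ne'
    fun_prop
  · refine ContinuousOn.mul (ContinuousOn.div (by fun_prop) (by fun_prop) ?_) (by fun_prop)
    rintro ⟨t, x⟩ ⟨ht, -⟩
    exact (hpos t (by simpa using ht) x).ne'
  · intro t ht x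
    have h1 : HasDerivAt (fun s : ℝ => 1 + s * u x) (u x) t := by
      simpa using ((hasDerivAt_id t).mul_const (u x)).const_add 1
    exact ((h1.log (hpos t ht x).ne').const_add (c x)).mul_const (g x)

/-! ### Right invariant vector fields -/

/-- The central component of the right invariant field of `(k, 0)` at a point with coordinates
`(f, τ)`: the integral `½ ∫ k'(f(x)) d log f'(x)`. -/
noncomputable def fieldCocycle (f k : ℝ → ℝ) : ℝ :=
  1 / 2 * ∫ x in (0 : ℝ)..(2 * π), deriv k (f x) * deriv (fun y => log (deriv f y)) x

theorem hasDerivAt_of_mem {h : ℝ → ℝ} (hh : h ∈ SmoothPer) (x : ℝ) :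
    HasDerivAt h (deriv h x) x :=
  (hh.1.differentiable (by simp) x).hasDerivAt

theorem isLift_id : IsLift fun x => x :=
  ⟨contDiff_id, fun _ => rfl, fun x => by simp⟩

theorem eventually_abs_lt {δ : ℝ} (hδ : 0 < δ) : ∀ᶠ t : ℝ in 𝓝 0, |t| < δ := by
  filter_upwards [Metric.ball_mem_nhds (0 : ℝ) hδ] with t ht
  simpa using ht

section

variable {f h : ℝ → ℝ} (hf : IsLift f) (hh : h ∈ SmoothPer)
include hf hh

theorem deriv_add_mul_comp (t : ℝ) :
    deriv (fun x => f x + t * h (f x)) = fun x => deriv f x * (1 + t * deriv h (f x)) := by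
  funext x
  have h1 := (hf.hasDerivAt x).add
    (((hasDerivAt_of_mem hh (f x)).comp x (hf.hasDerivAt x)).const_mul t)
  refine Eq.trans h1.deriv ?_
  ring

theorem isLift_add_mul_comp {M t : ℝ} (hM : 0 < M) (hhM : ∀ x, |deriv h x| ≤ M)
    (ht : |t| < 1 / M) : IsLift fun x => f x + t * h (f x) := by
  refine ⟨hf.1.add (contDiff_const.mul (hh.1.comp hf.1)), fun x => ?_, fun x => ?_⟩
  · simp only [hf.2.1, hh.2 (f x)]; ring
  · rw [deriv_add_mul_comp hf hh]
    exact mul_pos (hf.2.2 x) (one_add_mul_pos hM (hhM _) ht)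

/-- The derivative of `bott (id + t h) f` at `t = 0`. -/
theorem hasDerivAt_bott_add_mul :
    HasDerivAt (fun t => bott (fun x => x + t * h x) f) (2 * fieldCocycle f h) 0 := by
  obtain ⟨M, hM, hhM⟩ := exists_abs_le_of_mem_smoothPer (deriv_mem_smoothPer hh)
  have key := hasDerivAt_integral_log_mul (a := 0) (b := 2 * π) hf.log_deriv_mem.1.continuous
    (hf.comp_mem (deriv_mem_smoothPer hh)).1.continuous hf.deriv_log_mem.1.continuous hM
    fun x => hhM (f x)
  have e : 2 * fieldCocycle f h = ∫ x in (0 : ℝ)..(2 * π),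
      (deriv h ∘ f) x * deriv (fun y => log (deriv f y)) x := by
    simp only [fieldCocycle, Function.comp_apply]; ring
  rw [e]
  refine key.congr_of_eventuallyEq ?_
  filter_upwards [eventually_abs_lt (one_div_pos.2 hM)] with t ht
  have h1 : (fun x => x + t * h x) ∘ f = fun x => f x + t * h (f x) := rfl
  simp only [bott, h1, deriv_add_mul_comp hf hh]
  congr 1
  funext x
  rw [log_mul (hf.2.2 x).ne' (one_add_mul_pos hM (hhM _) ht).ne']
  rfl

/-- The integrals `∫ h' d log g'` and `∫ h'(f) d log f'` for `g = f⁻¹` are opposite to each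
other. -/
theorem integral_deriv_mul_deriv_log_invFun :
    ∫ x in (0 : ℝ)..(2 * π), deriv h x * deriv (fun y => log (deriv (Function.invFun f) y)) x =
      -(2 * fieldCocycle f h) := by
  have hg := hf.invFun
  -- This is the derivative of `log g'(f(y)) = -log f'(y)`.
  have h1 : ∀ y, deriv (fun y => log (deriv (Function.invFun f) y)) (f y) * deriv f y =
      -deriv (fun y => log (deriv f y)) y := fun y => by
    have h2 := (hasDerivAt_of_mem hg.log_deriv_mem (f y)).comp y (hf.hasDerivAt y)
    have h3 : (fun y => log (deriv (Function.invFun f) y)) ∘ f = fun y => -log (deriv f y) := by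
      funext z
      have h4 := (hg.hasDerivAt (f z)).comp z (hf.hasDerivAt z)
      have h5 : Function.invFun f ∘ f = id := funext hf.invFun_apply
      rw [h5] at h4
      have h6 := h4.unique (hasDerivAt_id z)
      simp only [Function.comp_apply]
      rw [← log_inv, eq_inv_of_mul_eq_one_left h6]
    rw [h3] at h2
    rw [← h2.deriv, deriv.fun_neg]
  have h7 : (fun x => deriv h x * deriv (fun y => log (deriv (Function.invFun f) y)) x) ∈
      SmoothPer :=
    smoothPerAlg.mul_mem (deriv_mem_smoothPer hh) hg.deriv_log_mem
  rw [← hf.integral_comp_mul_deriv h7]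
  simp only [mul_assoc, h1, fieldCocycle, mul_neg, intervalIntegral.integral_neg]
  ring

/-- The derivative of `bott (f + t h ∘ f) f⁻¹` at `t = 0`. -/
theorem hasDerivAt_bott_invFun :
    HasDerivAt (fun t => bott (fun x => f x + t * h (f x)) (Function.invFun f))
      (-(2 * fieldCocycle f h)) 0 := by
  obtain ⟨M, hM, hhM⟩ := exists_abs_le_of_mem_smoothPer (deriv_mem_smoothPer hh)
  have key := hasDerivAt_integral_log_mul (a := 0) (b := 2 * π) (c := fun _ => 0)
    continuous_const (deriv_mem_smoothPer hh).1.continuous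
    hf.invFun.deriv_log_mem.1.continuous hM hhM
  rw [integral_deriv_mul_deriv_log_invFun hf hh] at key
  convert key using 2 with t
  -- Composed with `f⁻¹`, the curve `f + t h ∘ f` becomes `id + t h`.
  have h1 : (fun x => f x + t * h (f x)) ∘ Function.invFun f = fun x => x + t * h x := by
    funext x
    simp only [Function.comp_apply, hf.apply_invFun]
  simp only [bott, h1, deriv_add_mul_comp isLift_id hh, deriv_id'', one_mul, zero_add]

/-- The derivative of `fieldCocycle` along a right invariant field. -/
theorem hasDerivAt_fieldCocycle {k : ℝ → ℝ} (hk : k ∈ SmoothPer) :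
    HasDerivAt (fun t => fieldCocycle (fun x => f x + t * h (f x)) k)
      (1 / 2 * ∫ x in (0 : ℝ)..(2 * π),
        (deriv (deriv k) (f x) * h (f x) * deriv (fun y => log (deriv f y)) x
          + deriv k (f x) * (deriv (deriv h) (f x) * deriv f x))) 0 := by
  have hh' := deriv_mem_smoothPer hh
  have hh'' := deriv_mem_smoothPer hh'
  have hk' := deriv_mem_smoothPer hk
  have hk'' := deriv_mem_smoothPer hk'
  obtain ⟨M, hM, hhM⟩ := exists_abs_le_of_mem_smoothPer hh'
  have hpos : ∀ t, |t| < 1 / M → ∀ x, 0 < 1 + t * deriv h (f x) := fun t ht x =>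
    one_add_mul_pos hM (hhM _) ht
  have cf := hf.1.continuous
  have cf' := hf.deriv_mem.1.continuous
  have ch := hh.1.continuous
  have ch' := hh'.1.continuous
  have ch'' := hh''.1.continuous
  have ck' := hk'.1.continuous
  have ck'' := hk''.1.continuous
  have cG := hf.deriv_log_mem.1.continuous
  set G := deriv (fun y => log (deriv f y)) with hG
  -- The derivative of `log (f + t h ∘ f)'`.
  have hlog : ∀ t, |t| < 1 / M → ∀ x,
      deriv (fun y => log (deriv (fun x => f x + t * h (f x)) y)) x =
        G x + t * (deriv (deriv h) (f x) * deriv f x) / (1 + t * deriv h (f x)) := by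
    intro t ht x
    have e : (fun y => log (deriv (fun x => f x + t * h (f x)) y)) =
        fun y => log (deriv f y) + log (1 + t * deriv h (f y)) := by
      funext y
      rw [deriv_add_mul_comp hf hh, log_mul (hf.2.2 y).ne' (hpos t ht y).ne']
    rw [e]
    have h1 : HasDerivAt (fun y => 1 + t * deriv h (f y))
        (t * (deriv (deriv h) (f x) * deriv f x)) x :=
      ((((hasDerivAt_of_mem hh' (f x)).comp x (hf.hasDerivAt x)).const_mul t).const_add 1)
    exact ((hasDerivAt_of_mem hf.log_deriv_mem x).add (h1.log (hpos t ht x).ne')).deriv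
  have key := hasDerivAt_integral_of_continuousOn (a := 0) (b := 2 * π) (δ := 1 / M)
    (F := fun t x => deriv k (f x + t * h (f x)) *
      (G x + t * (deriv (deriv h) (f x) * deriv f x) / (1 + t * deriv h (f x))))
    (F' := fun t x => deriv (deriv k) (f x + t * h (f x)) * h (f x) *
        (G x + t * (deriv (deriv h) (f x) * deriv f x) / (1 + t * deriv h (f x)))
      + deriv k (f x + t * h (f x)) *
        ((deriv (deriv h) (f x) * deriv f x) / (1 + t * deriv h (f x)) ^ 2))
    (by positivity) ?_ ?_ ?_
  · simp only [zero_mul, add_zero, one_pow, div_one] at key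
    refine (key.const_mul (1 / 2)).congr_of_eventuallyEq ?_
    filter_upwards [eventually_abs_lt (one_div_pos.2 hM)] with t ht
    simp only [fieldCocycle, hlog t ht]
  · intro t ht
    have : Continuous fun x =>
        t * (deriv (deriv h) (f x) * deriv f x) / (1 + t * deriv h (f x)) :=
      Continuous.div (by fun_prop) (by fun_prop) fun x => (hpos t ht x).ne'
    fun_prop
  · have hne : ∀ q ∈ Metric.ball (0 : ℝ) (1 / M) ×ˢ (Set.univ : Set ℝ),
        1 + q.1 * deriv h (f q.2) ≠ 0 := fun q hq => (hpos q.1 (by simpa using hq.1) _).ne'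
    have c1 : ContinuousOn (fun q : ℝ × ℝ =>
        q.1 * (deriv (deriv h) (f q.2) * deriv f q.2) / (1 + q.1 * deriv h (f q.2)))
        (Metric.ball (0 : ℝ) (1 / M) ×ˢ (Set.univ : Set ℝ)) :=
      ContinuousOn.div (by fun_prop) (by fun_prop) hne
    have c2 : ContinuousOn (fun q : ℝ × ℝ =>
        (deriv (deriv h) (f q.2) * deriv f q.2) / (1 + q.1 * deriv h (f q.2)) ^ 2)
        (Metric.ball (0 : ℝ) (1 / M) ×ˢ (Set.univ : Set ℝ)) :=
      ContinuousOn.div (by fun_prop) (by fun_prop) fun q hq => pow_ne_zero 2 (hne q hq)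
    simp only [Function.uncurry_def]
    fun_prop
  · intro t ht x
    have d1 : HasDerivAt (fun s : ℝ => f x + s * h (f x)) (h (f x)) t := by
      simpa using ((hasDerivAt_id t).mul_const (h (f x))).const_add (f x)
    have d2 := (hasDerivAt_of_mem hk' (f x + t * h (f x))).comp t d1
    have d3 : HasDerivAt (fun s : ℝ => 1 + s * deriv h (f x)) (deriv h (f x)) t := by
      simpa using ((hasDerivAt_id t).mul_const (deriv h (f x))).const_add 1
    have d4 := (((hasDerivAt_id t).mul_const (deriv (deriv h) (f x) * deriv f x)).div d3
      (hpos t ht x).ne').const_add (G x)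
    refine (d2.mul d4).congr_deriv ?_
    simp only [Function.comp_apply, Pi.div_apply, id_eq]
    ring

end

section

variable {p : Coord} (hp : p ∈ points)
include hp

/-- The value of a right invariant field; its central component is the derivative of the Bott
cocycle. -/
theorem rightField_eq (X : Vir) :
    rightField X p = (X.1.1 ∘ p.1, X.2 + fieldCocycle p.1 X.1.1) := by
  refine Prod.ext (funext fun x => ?_) ?_
  · have : HasDerivAt (fun t : ℝ => p.1 x + t * X.1.1 (p.1 x)) (X.1.1 (p.1 x)) 0 := by
      simpa using ((hasDerivAt_id (0 : ℝ)).mul_const (X.1.1 (p.1 x))).const_add (p.1 x)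
    exact this.deriv
  · have h1 := ((((hasDerivAt_id (0 : ℝ)).mul_const X.2).add_const p.2).add
      ((hasDerivAt_bott_add_mul hp X.1.2).div_const 2))
    refine Eq.trans h1.deriv ?_
    ring

/-- The right trivialisation inverts `X ↦ rightField X p`. -/
theorem rightTriv_rightField (X : Vir) : rightTriv p (rightField X p) = (X.1.1, X.2) := by
  have hp' : IsLift p.1 := hp
  rw [rightField_eq hp]
  refine Prod.ext (funext fun x => ?_) ?_
  · have : HasDerivAt (fun t : ℝ => p.1 (Function.invFun p.1 x)
        + t * X.1.1 (p.1 (Function.invFun p.1 x))) (X.1.1 (p.1 (Function.invFun p.1 x))) 0 := by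
      simpa using ((hasDerivAt_id (0 : ℝ)).mul_const
        (X.1.1 (p.1 (Function.invFun p.1 x)))).const_add (p.1 (Function.invFun p.1 x))
    refine Eq.trans this.deriv ?_
    rw [hp'.apply_invFun]
  · have h1 := (((((hasDerivAt_id (0 : ℝ)).mul_const (X.2 + fieldCocycle p.1 X.1.1)).const_add
      p.2).add_const (-p.2)).add ((hasDerivAt_bott_invFun hp X.1.2).div_const 2))
    refine Eq.trans h1.deriv ?_
    ring

/-- Every tangent vector is a value of a right invariant field. -/
theorem exists_rightField_eq {v : Coord} (hv : v.1 ∈ SmoothPer) : ∃ X, rightField X p = v := by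
  have hp' : IsLift p.1 := hp
  refine ⟨(⟨v.1 ∘ Function.invFun p.1, hp'.invFun.comp_mem hv⟩,
    v.2 - fieldCocycle p.1 (v.1 ∘ Function.invFun p.1)), ?_⟩
  rw [rightField_eq hp]
  refine Prod.ext (funext fun x => ?_) ?_
  · simp only [Function.comp_apply, hp'.invFun_apply]
  · simp only [sub_add_cancel]

theorem rightField_mem (X : Vir) : (rightField X p).1 ∈ SmoothPer := by
  have hp' : IsLift p.1 := hp
  rw [rightField_eq hp]
  exact hp'.comp_mem X.1.2

/-- A short straight segment in the direction of a tangent vector consists of points of the group,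
so that derivatives of a field along another one involve only its values at such points. -/
theorem eventually_add_smul_rightField_mem (X : Vir) :
    ∀ᶠ t : ℝ in 𝓝 0, p + t • rightField X p ∈ points := by
  obtain ⟨M, hM, hhM⟩ := exists_abs_le_of_mem_smoothPer (deriv_mem_smoothPer X.1.2)
  filter_upwards [eventually_abs_lt (one_div_pos.2 hM)] with t ht
  rw [rightField_eq hp]
  exact isLift_add_mul_comp hp X.1.2 hM hhM ht

end

/-- The right invariant field of an element of the Lie algebra, the latter given as a pair with
first entry in the algebra `smoothPerAlg`. -/
noncomputable def invField (X : smoothPerAlg × ℝ) (p : Coord) : Coord :=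
  rightField (virEquiv.symm X) p

theorem invField_virEquiv (X : Vir) : invField (virEquiv X) = rightField X := rfl

theorem velocity_congr {c c' : ℝ → Coord} (h : c =ᶠ[𝓝 0] c') : velocity c = velocity c' := by
  refine Prod.ext (funext fun x => ?_) ?_
  · exact EventuallyEq.deriv_eq (h.mono fun t ht => by simp only [ht])
  · exact EventuallyEq.deriv_eq (h.mono fun t ht => by simp only [ht])

/-- The `L²` inner product is nondegenerate. -/
theorem eq_of_forall_algInner_eq {X Y : smoothPerAlg × ℝ}
    (h : ∀ Z, algInner perInt X Z = algInner perInt Y Z) : X = Y := by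
  have h0 : algInner perInt (X - Y) (X - Y) = 0 := by
    have := h (X - Y)
    simp only [algInner, Prod.fst_sub, Prod.snd_sub, sub_mul, map_sub] at this ⊢
    linear_combination this
  rw [← sub_eq_zero]
  generalize X - Y = D at h0 ⊢
  obtain ⟨w, c⟩ := D
  have hw : 0 ≤ perInt (w * w) :=
    intervalIntegral.integral_nonneg two_pi_pos.le fun x _ => mul_self_nonneg (w.1 x)
  simp only [algInner] at h0
  have hc : c = 0 := by nlinarith
  have hw0 : perInt (w * w) = 0 := by rw [hc] at h0; linarith
  refine Prod.ext (Subtype.ext (funext fun x => ?_)) hc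
  by_contra hx
  obtain ⟨y, hy, hxy⟩ := w.2.2.exists_mem_Ico₀ two_pi_pos x
  refine (intervalIntegral.integral_pos two_pi_pos (w * w).2.1.continuous.continuousOn
    (fun z _ => mul_self_nonneg (w.1 z)) ⟨y, Set.Ico_subset_Icc_self hy, ?_⟩).ne' hw0
  exact mul_self_pos.2 (hxy ▸ hx)

section

variable {p : Coord} (hp : p ∈ points)
include hp

theorem rightTriv_invField (X : smoothPerAlg × ℝ) : rightTriv p (invField X p) = (X.1.1, X.2) :=
  rightTriv_rightField hp _

theorem metric_invField (X Y : smoothPerAlg × ℝ) :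
    metric p (invField X p) (invField Y p) = algInner perInt X Y := by
  rw [metric, rightTriv_invField hp, rightTriv_invField hp]
  rfl

theorem invField_sub (X Y : smoothPerAlg × ℝ) :
    invField (X - Y) p = invField X p - invField Y p := by
  have hp' : IsLift p.1 := hp
  simp only [invField, rightField_eq hp]
  refine Prod.ext rfl ?_
  have h1 : ∀ Z : smoothPerAlg × ℝ, IntervalIntegrable (fun x => deriv Z.1.1 (p.1 x) *
      deriv (fun y => log (deriv p.1 y)) x) volume 0 (2 * π) := fun Z =>
    ((hp'.comp_mem (deriv_mem_smoothPer Z.1.2)).1.continuous.mul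
      hp'.deriv_log_mem.1.continuous).intervalIntegrable _ _
  have h2 : ∀ x, deriv (X - Y).1.1 x = deriv X.1.1 x - deriv Y.1.1 x := fun x =>
    congrFun (congrArg Subtype.val (map_sub perDeriv X.1 Y.1)) x
  change X.2 - Y.2 + fieldCocycle p.1 (X - Y).1.1 =
    X.2 + fieldCocycle p.1 X.1.1 - (Y.2 + fieldCocycle p.1 Y.1.1)
  simp only [fieldCocycle, h2, sub_mul]
  rw [intervalIntegral.integral_sub (h1 X) (h1 Y)]
  ring

theorem invField_smul (r : ℝ) (X : smoothPerAlg × ℝ) :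
    invField (r • X) p = r • invField X p := by
  simp only [invField, rightField_eq hp]
  refine Prod.ext rfl ?_
  have h2 : ∀ x, deriv (r • X).1.1 x = r * deriv X.1.1 x := fun x =>
    congrFun (congrArg Subtype.val (Derivation.map_smul perDeriv r X.1)) x
  change r * X.2 + fieldCocycle p.1 (r • X).1.1 = r * (X.2 + fieldCocycle p.1 X.1.1)
  simp only [fieldCocycle, h2, mul_assoc]
  rw [intervalIntegral.integral_const_mul]
  ring

/-- The derivative of a right invariant field along another one. -/
theorem velocity_rightField (X Y : Vir) :
    velocity (fun t => rightField Y (p + t • rightField X p)) =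
      (fun x => deriv Y.1.1 (p.1 x) * X.1.1 (p.1 x), 1 / 2 * ∫ x in (0 : ℝ)..(2 * π),
        (deriv (deriv Y.1.1) (p.1 x) * X.1.1 (p.1 x) * deriv (fun y => log (deriv p.1 y)) x
          + deriv Y.1.1 (p.1 x) * (deriv (deriv X.1.1) (p.1 x) * deriv p.1 x))) := by
  have h1 : (fun t : ℝ => rightField Y (p + t • rightField X p)) =ᶠ[𝓝 0] fun t =>
      (fun x => Y.1.1 (p.1 x + t * X.1.1 (p.1 x)),
        Y.2 + fieldCocycle (fun x => p.1 x + t * X.1.1 (p.1 x)) Y.1.1) := by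
    filter_upwards [eventually_add_smul_rightField_mem hp X] with t ht
    rw [rightField_eq ht, rightField_eq hp]
    rfl
  rw [velocity_congr h1]
  refine Prod.ext (funext fun x => ?_) ?_
  · have d1 : HasDerivAt (fun s : ℝ => p.1 x + s * X.1.1 (p.1 x)) (X.1.1 (p.1 x)) 0 := by
      simpa using ((hasDerivAt_id (0 : ℝ)).mul_const (X.1.1 (p.1 x))).const_add (p.1 x)
    have d2 := (hasDerivAt_of_mem Y.1.2 (p.1 x + 0 * X.1.1 (p.1 x))).comp 0 d1
    rw [zero_mul, add_zero] at d2
    exact d2.deriv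
  · exact ((hasDerivAt_fieldCocycle hp X.1.2 Y.1.2).const_add Y.2).deriv

/-- The bracket of right invariant fields is the opposite of the bracket of the Lie algebra. -/
theorem lieBracket_eq {V W : Coord → Coord} {X Y : smoothPerAlg × ℝ}
    (hV : ∀ q ∈ points, V q = invField X q) (hW : ∀ q ∈ points, W q = invField Y q) :
    lieBracket V W p = invField (-algBracket perDeriv perInt X Y) p := by
  have hp' : IsLift p.1 := hp
  -- Only the values at points of the group enter the derivatives.
  have hc : ∀ {V W : Coord → Coord} {X Y : smoothPerAlg × ℝ},
      (∀ q ∈ points, V q = invField X q) → (∀ q ∈ points, W q = invField Y q) →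
      velocity (fun t => W (p + t • V p)) =
        velocity (fun t => rightField (virEquiv.symm Y) (p + t • invField X p)) := by
    intro V W X Y hV hW
    refine velocity_congr ?_
    filter_upwards [eventually_add_smul_rightField_mem hp (virEquiv.symm X)] with t ht
    change p + t • invField X p ∈ points at ht
    rw [hV p hp, hW _ ht]
    rfl
  rw [lieBracket, hc hV hW, hc hW hV]
  simp only [invField]
  rw [velocity_rightField hp, velocity_rightField hp, rightField_eq hp]
  obtain ⟨h, a⟩ := X
  obtain ⟨k, b⟩ := Y
  refine Prod.ext (funext fun x => ?_) ?_
  · change deriv k.1 (p.1 x) * h.1 (p.1 x) - deriv h.1 (p.1 x) * k.1 (p.1 x) =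
      -(deriv h.1 (p.1 x) * k.1 (p.1 x) - h.1 (p.1 x) * deriv k.1 (p.1 x))
    ring
  · have hq : perDeriv (-(perDeriv h * k - h * perDeriv k)) =
        perDeriv (perDeriv k) * h - perDeriv (perDeriv h) * k := by
      simp only [map_neg, map_sub, Derivation.leibniz, smul_eq_mul]
      ring
    have hq' : ∀ x, deriv (-(perDeriv h * k - h * perDeriv k)).1 x =
        deriv (deriv k.1) x * h.1 x - deriv (deriv h.1) x * k.1 x := fun x =>
      congrFun (congrArg Subtype.val hq) x
    -- The terms without `d log f'` are half the integral of `(k'h'' - h'k'') ∘ f · f'`, which is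
    -- `-2ω(h, k)` after the change of variables.
    have hI := algCocycle_antisymm perInt_perDeriv h k
    have hcv := hp'.integral_comp_mul_deriv
      (perDeriv k * perDeriv (perDeriv h) - perDeriv h * perDeriv (perDeriv k)).2
    have hcv' : ∫ x in (0 : ℝ)..(2 * π), (deriv k.1 (p.1 x) * deriv (deriv h.1) (p.1 x)
        - deriv h.1 (p.1 x) * deriv (deriv k.1) (p.1 x)) * deriv p.1 x =
        -2 * algCocycle perDeriv perInt h k := by
      refine hcv.trans (Eq.trans (map_sub perInt _ _) ?_)
      simp only [algCocycle] at hI ⊢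
      linarith
    have cf := hp'.1.continuous
    have cf' := hp'.deriv_mem.1.continuous
    have ch := h.2.1.continuous
    have ck := k.2.1.continuous
    have ch' := (perDeriv h).2.1.continuous
    have ck' := (perDeriv k).2.1.continuous
    have ch'' := (perDeriv (perDeriv h)).2.1.continuous
    have ck'' := (perDeriv (perDeriv k)).2.1.continuous
    have cG := hp'.deriv_log_mem.1.continuous
    change Continuous (deriv h.1) at ch'
    change Continuous (deriv k.1) at ck'
    change Continuous (deriv (deriv h.1)) at ch''
    change Continuous (deriv (deriv k.1)) at ck''
    change 1 / 2 * (∫ x in (0 : ℝ)..(2 * π),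
          (deriv (deriv k.1) (p.1 x) * h.1 (p.1 x) * deriv (fun y => log (deriv p.1 y)) x
          + deriv k.1 (p.1 x) * (deriv (deriv h.1) (p.1 x) * deriv p.1 x)))
        - 1 / 2 * (∫ x in (0 : ℝ)..(2 * π),
          (deriv (deriv h.1) (p.1 x) * k.1 (p.1 x) * deriv (fun y => log (deriv p.1 y)) x
          + deriv h.1 (p.1 x) * (deriv (deriv k.1) (p.1 x) * deriv p.1 x))) =
      -algCocycle perDeriv perInt h k
        + fieldCocycle p.1 (-(perDeriv h * k - h * perDeriv k)).1
    have hs : algCocycle perDeriv perInt h k = -(1 / 2) * ∫ x in (0 : ℝ)..(2 * π),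
        (deriv k.1 (p.1 x) * deriv (deriv h.1) (p.1 x)
        - deriv h.1 (p.1 x) * deriv (deriv k.1) (p.1 x)) * deriv p.1 x := by
      rw [hcv']; ring
    rw [hs, fieldCocycle, ← mul_sub, ← intervalIntegral.integral_sub, ← neg_mul, neg_neg,
      ← mul_add, ← intervalIntegral.integral_add]
    · congr 2
      funext x
      rw [hq']
      ring
    · exact Continuous.intervalIntegrable (by fun_prop) _ _
    · simp only [hq']
      exact Continuous.intervalIntegrable (by fun_prop) _ _
    · exact Continuous.intervalIntegrable (by fun_prop) _ _
    · exact Continuous.intervalIntegrable (by fun_prop) _ _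

/-- Inner products of right invariant fields are constant. -/
theorem dirDeriv_metric_eq_zero {V V' W : Coord → Coord} {X Y Z : smoothPerAlg × ℝ}
    (hV : V p = invField X p) (hV' : ∀ q ∈ points, V' q = invField Y q)
    (hW : ∀ q ∈ points, W q = invField Z q) :
    dirDeriv V (fun q => metric q (V' q) (W q)) p = 0 := by
  have h1 : (fun t : ℝ => metric (p + t • V p) (V' (p + t • V p)) (W (p + t • V p))) =ᶠ[𝓝 0]
      fun _ => algInner perInt Y Z := by
    filter_upwards [eventually_add_smul_rightField_mem hp (virEquiv.symm X)] with t ht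
    change p + t • invField X p ∈ points at ht
    rw [hV, hV' _ ht, hW _ ht, metric_invField ht]
  rw [dirDeriv, h1.deriv_eq, deriv_const]

end

/-! ### The Levi-Civita connection and the curvature -/

/-- The covariant derivative of right invariant fields exists, is unique and is right
invariant. -/
theorem isCovDeriv_iff {V W U : Coord → Coord} {X Y : smoothPerAlg × ℝ}
    (hV : ∀ q ∈ points, V q = invField X q) (hW : ∀ q ∈ points, W q = invField Y q) :
    IsCovDeriv V W U ↔
      ∀ p ∈ points, U p = invField (algNabla perDeriv perInt X Y) p := by
  refine forall₂_congr fun p hp => ?_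
  -- The right hand side of the Koszul formula.
  have key : ∀ Z : smoothPerAlg × ℝ,
      dirDeriv V (fun q => metric q (W q) (invField Z q)) p
      + dirDeriv W (fun q => metric q (V q) (invField Z q)) p
      - dirDeriv (invField Z) (fun q => metric q (V q) (W q)) p
      + metric p (lieBracket V W p) (invField Z p)
      - metric p (lieBracket V (invField Z) p) (W p)
      - metric p (lieBracket W (invField Z) p) (V p) =
      2 * algInner perInt (algNabla perDeriv perInt X Y) Z := fun Z => by
    have hZ : ∀ q ∈ points, invField Z q = invField Z q := fun _ _ => rfl
    rw [dirDeriv_metric_eq_zero hp (hV p hp) hW hZ, dirDeriv_metric_eq_zero hp (hW p hp) hV hZ,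
      dirDeriv_metric_eq_zero hp (hZ p hp) hV hW, lieBracket_eq hp hV hW,
      lieBracket_eq hp hV hZ, lieBracket_eq hp hW hZ, hV p hp, hW p hp]
    simp only [metric_invField hp, two_mul_algInner_algNabla perInt_perDeriv]
    ring
  constructor
  · rintro ⟨h1, h2⟩
    obtain ⟨Q, hQ⟩ := exists_rightField_eq hp h1
    rw [← hQ, ← invField_virEquiv]
    congr 1
    refine eq_of_forall_algInner_eq fun Z => ?_
    have h3 := h2 (virEquiv.symm Z)
    change _ * metric p (U p) (invField Z p) = _ at h3
    have h4 := h3.trans (key Z)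
    rw [← hQ, ← invField_virEquiv, metric_invField hp] at h4
    linarith
  · intro h1
    refine ⟨h1 ▸ rightField_mem hp _, fun X' => ?_⟩
    have h2 := key (virEquiv X')
    rw [← metric_invField hp, ← h1] at h2
    exact h2.symm

/-- The curvature of right invariant fields exists, is unique and is right invariant. -/
theorem isCurvature_iff {C : Coord → Coord} (X Y Z : smoothPerAlg × ℝ) :
    IsCurvature (invField X) (invField Y) (invField Z) C ↔
      ∀ p ∈ points, C p = invField (algCurv perDeriv perInt X Y Z) p := by
  have hr : ∀ X : smoothPerAlg × ℝ, ∀ q ∈ points, invField X q = invField X q :=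
    fun _ _ _ => rfl
  have hb : ∀ q ∈ points, lieBracket (invField X) (invField Y) q =
      invField (-algBracket perDeriv perInt X Y) q := fun q hq =>
    lieBracket_eq hq (hr X) (hr Y)
  constructor
  · rintro ⟨A, B, A', B', D, hA, hA', hB, hB', hD, hC⟩ p hp
    rw [isCovDeriv_iff (hr _) (hr _)] at hA hB
    rw [isCovDeriv_iff (hr _) hA] at hA'
    rw [isCovDeriv_iff (hr _) hB] at hB'
    rw [isCovDeriv_iff hb (hr _)] at hD
    rw [hC p hp, hA' p hp, hB' p hp, hD p hp, algCurv, invField_sub hp, invField_sub hp]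
  · intro hC
    refine ⟨_, _, _, _, _, (isCovDeriv_iff (hr _) (hr _)).2 (hr _),
      (isCovDeriv_iff (hr _) (hr _)).2 (hr _), (isCovDeriv_iff (hr _) (hr _)).2 (hr _),
      (isCovDeriv_iff (hr _) (hr _)).2 (hr _), (isCovDeriv_iff hb (hr _)).2 (hr _),
      fun p hp => ?_⟩
    rw [hC p hp, algCurv, invField_sub hp, invField_sub hp]

/-! ### The curvature formulas on the circle -/

theorem coe_perDeriv (h : smoothPerAlg) : (perDeriv h : ℝ → ℝ) = deriv h := rfl

theorem perInt_apply (h : smoothPerAlg) :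
    perInt h = ∫ x in (0 : ℝ)..(2 * π), (h : ℝ → ℝ) x := rfl

theorem gf_eq (h k : smoothPerAlg) : gf h k = algCocycle perDeriv perInt h k := by
  simp only [gf, iteratedDeriv_succ, iteratedDeriv_zero]
  rfl

/-- A smooth periodic function as an element of the algebra `smoothPerAlg`. -/
def toAlg (h : SmoothPer) : smoothPerAlg := ⟨h.1, h.2⟩

theorem coe_toAlg (h : SmoothPer) : (toAlg h : ℝ → ℝ) = h := rfl

variable {h₁ h₂ h₃ : SmoothPer} {a₁ a₂ a₃ : ℝ} {C : Coord → Coord} {p : Coord}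

theorem isCurvature_rightField_iff :
    IsCurvature (rightField (h₁, a₁)) (rightField (h₂, a₂)) (rightField (h₃, a₃)) C ↔
      ∀ p ∈ points, C p = invField
        (algCurv perDeriv perInt (toAlg h₁, a₁) (toAlg h₂, a₂) (toAlg h₃, a₃)) p :=
  isCurvature_iff (toAlg h₁, a₁) (toAlg h₂, a₂) (toAlg h₃, a₃)

/-- The right trivialisation of the curvature is `algCurv` at every point. -/
theorem rightTriv_curvature
    (hC : IsCurvature (rightField (h₁, a₁)) (rightField (h₂, a₂)) (rightField (h₃, a₃)) C)
    (hp : p ∈ points) : rightTriv p ((4 : ℝ) • C p) =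
      ((((4 : ℝ) • algCurv perDeriv perInt (toAlg h₁, a₁) (toAlg h₂, a₂) (toAlg h₃, a₃)).1 :
        ℝ → ℝ),
        ((4 : ℝ) • algCurv perDeriv perInt (toAlg h₁, a₁) (toAlg h₂, a₂) (toAlg h₃, a₃)).2) := by
  rw [isCurvature_rightField_iff.1 hC p hp, ← invField_smul hp, rightTriv_invField hp]

/-- The curvature operator as a matrix. -/
theorem rightTriv_curvature_eq_entries
    (hC : IsCurvature (rightField (h₁, a₁)) (rightField (h₂, a₂)) (rightField (h₃, a₃)) C)
    (hp : p ∈ points) : rightTriv p ((4 : ℝ) • C p) =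
      (fun x => entry11 h₁ a₁ h₂ a₂ h₃ x + entry12 h₁ a₁ h₂ a₂ x * a₃,
        entry21 h₁ a₁ h₂ a₂ h₃ + 0 * a₃) := by
  rw [rightTriv_curvature hC hp, four_smul_algCurv_fst, four_smul_algCurv_snd perInt_perDeriv]
  simp only [← gf_eq]
  refine Prod.ext (funext fun x => ?_) ?_
  · simp only [entry11, entry12, iteratedDeriv_succ, iteratedDeriv_zero, Subalgebra.coe_add,
      Subalgebra.coe_sub, Subalgebra.coe_mul, Subalgebra.coe_smul, Pi.add_apply, Pi.sub_apply,
      Pi.mul_apply, Pi.smul_apply, smul_eq_mul, coe_perDeriv, coe_toAlg]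
    ring
  · simp only [entry21, zero_mul, add_zero]
    congr 2 <;> funext x
    all_goals
      simp only [iteratedDeriv_succ, iteratedDeriv_zero, Subalgebra.coe_add, Subalgebra.coe_mul,
        Subalgebra.coe_smul, Pi.add_apply, Pi.mul_apply, Pi.smul_apply, smul_eq_mul,
        coe_perDeriv, coe_toAlg]
      ring

/-- Misiolek's formula for the curvature. -/
theorem rightTriv_curvature_eq
    (hC : IsCurvature (rightField (h₁, a₁)) (rightField (h₂, a₂)) (rightField (h₃, a₃)) C)
    (hp : p ∈ points) : rightTriv p ((4 : ℝ) • C p) =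
        (fun x =>
          4 * (h₁.1 x * iteratedDeriv 2 h₂ x - iteratedDeriv 2 h₁ x * h₂.1 x) * h₃.1 x
          + 2 * (a₁ * iteratedDeriv 4 h₂ x - a₂ * iteratedDeriv 4 h₁ x) * h₃.1 x
          + (8 * (h₁.1 x * deriv h₂ x - deriv h₁ x * h₂.1 x)
            + 10 * (a₁ * iteratedDeriv 3 h₂ x - a₂ * iteratedDeriv 3 h₁ x)) * deriv h₃ x
          + 18 * (a₁ * iteratedDeriv 2 h₂ x - a₂ * iteratedDeriv 2 h₁ x) * iteratedDeriv 2 h₃ x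
          + 12 * (a₁ * deriv h₂ x - a₂ * deriv h₁ x) * iteratedDeriv 3 h₃ x
          + 2 * iteratedDeriv 3 h₃ x
            * (∫ y in (0 : ℝ)..(2 * Real.pi), deriv h₁ y * iteratedDeriv 2 h₂ y)
          - iteratedDeriv 3 h₁ x
            * (∫ y in (0 : ℝ)..(2 * Real.pi), deriv h₂ y * iteratedDeriv 2 h₃ y)
          + iteratedDeriv 3 h₂ x
            * (∫ y in (0 : ℝ)..(2 * Real.pi), deriv h₁ y * iteratedDeriv 2 h₃ y)
          + 2 * a₃ * (iteratedDeriv 3 h₁ x * deriv h₂ x - deriv h₁ x * iteratedDeriv 3 h₂ x)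
          + 2 * a₃ * (h₁.1 x * iteratedDeriv 4 h₂ x - iteratedDeriv 4 h₁ x * h₂.1 x)
          + a₃ * (a₁ * iteratedDeriv 6 h₂ x - a₂ * iteratedDeriv 6 h₁ x),
        (∫ x in (0 : ℝ)..(2 * Real.pi),
            iteratedDeriv 3 h₃ x * (a₁ * iteratedDeriv 3 h₂ x - a₂ * iteratedDeriv 3 h₁ x))
          + ∫ x in (0 : ℝ)..(2 * Real.pi),
            2 * deriv h₃ x * (h₁.1 x * iteratedDeriv 3 h₂ x - iteratedDeriv 3 h₁ x * h₂.1 x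
              - 2 * deriv h₁ x * iteratedDeriv 2 h₂ x + 2 * iteratedDeriv 2 h₁ x * deriv h₂ x)) :=
  by
  refine Prod.ext (funext fun x => ?_) ?_
  · rw [rightTriv_curvature_eq_entries hC hp]
    simp only [entry11, entry12, gf]
    ring
  · rw [rightTriv_curvature hC hp, four_smul_algCurv_snd' perInt_perDeriv]
    simp only [perInt_apply]
    congr 2 <;> funext x <;>
      simp only [iteratedDeriv_succ, iteratedDeriv_zero, Subalgebra.coe_add, Subalgebra.coe_sub,
        Subalgebra.coe_mul, Subalgebra.coe_smul, Pi.add_apply, Pi.sub_apply, Pi.mul_apply,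
        Pi.smul_apply, smul_eq_mul, coe_perDeriv, coe_toAlg]
    ring

theorem metric_curvature_eq
    (hC : IsCurvature (rightField (h₁, a₁)) (rightField (h₂, a₂)) (rightField (h₁, a₁)) C)
    (hp : p ∈ points) : metric p ((4 : ℝ) • C p) (rightField (h₂, a₂) p) =
        (∫ x in (0 : ℝ)..(2 * Real.pi),
          (-4 * (deriv h₁ x * h₂.1 x - h₁.1 x * deriv h₂ x) ^ 2
            + 4 * (a₁ * h₂.1 x - a₂ * h₁.1 x)
              * (h₁.1 x * iteratedDeriv 4 h₂ x - deriv h₁ x * iteratedDeriv 3 h₂ x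
                + iteratedDeriv 3 h₁ x * deriv h₂ x - iteratedDeriv 4 h₁ x * h₂.1 x)
            - (iteratedDeriv 3 h₂ x) ^ 2 * a₁ ^ 2
            + 2 * iteratedDeriv 3 h₁ x * iteratedDeriv 3 h₂ x * a₁ * a₂
            - (iteratedDeriv 3 h₁ x) ^ 2 * a₂ ^ 2))
          + 3 * gf h₁ h₂ ^ 2 := by
  rw [isCurvature_rightField_iff.1 hC p hp, ← invField_smul hp]
  change metric p _ (invField (toAlg h₂, a₂) p) = _
  rw [metric_invField hp, algInner_four_smul_algCurv perInt_perDeriv, ← gf_eq, perInt_apply]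
  congr 2
  funext x
  simp only [iteratedDeriv_succ, iteratedDeriv_zero, Subalgebra.coe_add, Subalgebra.coe_sub,
    Subalgebra.coe_mul, Subalgebra.coe_pow, Subalgebra.coe_smul, Pi.add_apply, Pi.sub_apply,
    Pi.mul_apply, Pi.pow_apply, Pi.smul_apply, smul_eq_mul, coe_perDeriv, coe_toAlg]
  ring

/-- The sectional curvature quantity of the plane spanned by `(sin, a₁)` and `(cos, a₂)`. -/
theorem metric_curvature_sin_cos
    (hC : IsCurvature (rightField (sinP, a₁)) (rightField (cosP, a₂)) (rightField (sinP, a₁)) C)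
    (hp : p ∈ points) : metric p ((4 : ℝ) • C p) (rightField (cosP, a₂) p) =
      -Real.pi * (8 + a₁ ^ 2 + a₂ ^ 2 - 3 * Real.pi) := by
  have hs : (sinP : ℝ → ℝ) = sin := rfl
  have hc : (cosP : ℝ → ℝ) = cos := rfl
  have hnc : deriv (fun x => -cos x) = sin := by funext x; simp
  have hns : deriv (fun x => -sin x) = fun x => -cos x := by funext x; simp
  have hw : gf sinP cosP = -π := by
    simp only [gf, hs, hc, iteratedDeriv_succ, iteratedDeriv_zero, Real.deriv_sin,
      Real.deriv_cos', hns]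
    have : ∀ x, cos x * -cos x = -(cos x ^ 2) := fun x => by ring
    simp only [this, intervalIntegral.integral_neg, integral_cos_sq]
    simp
  rw [metric_curvature_eq hC hp, hw]
  simp only [hs, hc, iteratedDeriv_succ, iteratedDeriv_zero, Real.deriv_sin, Real.deriv_cos',
    hns, hnc]
  have e : ∀ x : ℝ, (-4 * (cos x * cos x - sin x * -sin x) ^ 2
      + 4 * (a₁ * cos x - a₂ * sin x) * (sin x * cos x - cos x * sin x
        + -cos x * -sin x - sin x * cos x)
      - (sin x) ^ 2 * a₁ ^ 2 + 2 * -cos x * sin x * a₁ * a₂ - (-cos x) ^ 2 * a₂ ^ 2) =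
      -4 + (-a₁ ^ 2) * sin x ^ 2 + (-2 * a₁ * a₂) * (sin x * cos x)
        + (-a₂ ^ 2) * cos x ^ 2 := fun x => by
    have h1 : cos x * cos x - sin x * -sin x = 1 := by linarith [sin_sq_add_cos_sq x]
    rw [h1]; ring
  simp only [e]
  rw [intervalIntegral.integral_add, intervalIntegral.integral_add, intervalIntegral.integral_add,
    intervalIntegral.integral_const, intervalIntegral.integral_const_mul,
    intervalIntegral.integral_const_mul, intervalIntegral.integral_const_mul, integral_sin_sq,
    integral_sin_mul_cos₁, integral_cos_sq]
  · simp only [sin_two_pi, cos_two_pi, sin_zero, cos_zero, smul_eq_mul]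
    ring
  all_goals exact Continuous.intervalIntegrable (by fun_prop) _ _

end VirasoroBott

theorem mainTheorem6 :
    -- The curvature exists and is unique.
    (∀ X₁ X₂ X₃ : Vir,
      (∃ C, IsCurvature (rightField X₁) (rightField X₂) (rightField X₃) C) ∧
      ∀ C C', IsCurvature (rightField X₁) (rightField X₂) (rightField X₃) C →
        IsCurvature (rightField X₁) (rightField X₂) (rightField X₃) C' →
        ∀ p ∈ points, C p = C' p) ∧
    -- The curvature operator as a `2 × 2` matrix of operators.
    (∀ (h₁ h₂ h₃ : SmoothPer) (a₁ a₂ a₃ : ℝ) (C : Coord → Coord),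
      IsCurvature (rightField (h₁, a₁)) (rightField (h₂, a₂)) (rightField (h₃, a₃)) C →
      ∀ p ∈ points, rightTriv p ((4 : ℝ) • C p) =
        (fun x => entry11 h₁ a₁ h₂ a₂ h₃ x + entry12 h₁ a₁ h₂ a₂ x * a₃,
          entry21 h₁ a₁ h₂ a₂ h₃ + 0 * a₃)) ∧
    -- The curvature operator applied to a vector.
    (∀ (h₁ h₂ h₃ : SmoothPer) (a₁ a₂ a₃ : ℝ) (C : Coord → Coord),
      IsCurvature (rightField (h₁, a₁)) (rightField (h₂, a₂)) (rightField (h₃, a₃)) C →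
      ∀ p ∈ points, rightTriv p ((4 : ℝ) • C p) =
        (fun x =>
          4 * (h₁.1 x * iteratedDeriv 2 h₂ x - iteratedDeriv 2 h₁ x * h₂.1 x) * h₃.1 x
          + 2 * (a₁ * iteratedDeriv 4 h₂ x - a₂ * iteratedDeriv 4 h₁ x) * h₃.1 x
          + (8 * (h₁.1 x * deriv h₂ x - deriv h₁ x * h₂.1 x)
            + 10 * (a₁ * iteratedDeriv 3 h₂ x - a₂ * iteratedDeriv 3 h₁ x)) * deriv h₃ x
          + 18 * (a₁ * iteratedDeriv 2 h₂ x - a₂ * iteratedDeriv 2 h₁ x) * iteratedDeriv 2 h₃ x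
          + 12 * (a₁ * deriv h₂ x - a₂ * deriv h₁ x) * iteratedDeriv 3 h₃ x
          + 2 * iteratedDeriv 3 h₃ x
            * (∫ y in (0 : ℝ)..(2 * Real.pi), deriv h₁ y * iteratedDeriv 2 h₂ y)
          - iteratedDeriv 3 h₁ x
            * (∫ y in (0 : ℝ)..(2 * Real.pi), deriv h₂ y * iteratedDeriv 2 h₃ y)
          + iteratedDeriv 3 h₂ x
            * (∫ y in (0 : ℝ)..(2 * Real.pi), deriv h₁ y * iteratedDeriv 2 h₃ y)
          + 2 * a₃ * (iteratedDeriv 3 h₁ x * deriv h₂ x - deriv h₁ x * iteratedDeriv 3 h₂ x)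
          + 2 * a₃ * (h₁.1 x * iteratedDeriv 4 h₂ x - iteratedDeriv 4 h₁ x * h₂.1 x)
          + a₃ * (a₁ * iteratedDeriv 6 h₂ x - a₂ * iteratedDeriv 6 h₁ x),
        (∫ x in (0 : ℝ)..(2 * Real.pi),
            iteratedDeriv 3 h₃ x * (a₁ * iteratedDeriv 3 h₂ x - a₂ * iteratedDeriv 3 h₁ x))
          + ∫ x in (0 : ℝ)..(2 * Real.pi),
            2 * deriv h₃ x * (h₁.1 x * iteratedDeriv 3 h₂ x - iteratedDeriv 3 h₁ x * h₂.1 x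
              - 2 * deriv h₁ x * iteratedDeriv 2 h₂ x + 2 * iteratedDeriv 2 h₁ x * deriv h₂ x))) ∧
    -- The sectional curvature quantity `⟨4𝓡(X₁, X₂)X₁, X₂⟩`.
    (∀ (h₁ h₂ : SmoothPer) (a₁ a₂ : ℝ) (C : Coord → Coord),
      IsCurvature (rightField (h₁, a₁)) (rightField (h₂, a₂)) (rightField (h₁, a₁)) C →
      ∀ p ∈ points, metric p ((4 : ℝ) • C p) (rightField (h₂, a₂) p) =
        (∫ x in (0 : ℝ)..(2 * Real.pi),
          (-4 * (deriv h₁ x * h₂.1 x - h₁.1 x * deriv h₂ x) ^ 2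
            + 4 * (a₁ * h₂.1 x - a₂ * h₁.1 x)
              * (h₁.1 x * iteratedDeriv 4 h₂ x - deriv h₁ x * iteratedDeriv 3 h₂ x
                + iteratedDeriv 3 h₁ x * deriv h₂ x - iteratedDeriv 4 h₁ x * h₂.1 x)
            - (iteratedDeriv 3 h₂ x) ^ 2 * a₁ ^ 2
            + 2 * iteratedDeriv 3 h₁ x * iteratedDeriv 3 h₂ x * a₁ * a₂
            - (iteratedDeriv 3 h₁ x) ^ 2 * a₂ ^ 2))
          + 3 * gf h₁ h₂ ^ 2) ∧
    -- The value for `h₁ = sin`, `h₂ = cos`.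
    (∀ (a₁ a₂ : ℝ) (C : Coord → Coord),
      IsCurvature (rightField (sinP, a₁)) (rightField (cosP, a₂)) (rightField (sinP, a₁)) C →
      ∀ p ∈ points, metric p ((4 : ℝ) • C p) (rightField (cosP, a₂) p) =
        -Real.pi * (8 + a₁ ^ 2 + a₂ ^ 2 - 3 * Real.pi)) ∧
    -- The sign is not constant, already for these functions.
    (∃ (a₁ a₂ : ℝ) (C : Coord → Coord),
      IsCurvature (rightField (sinP, a₁)) (rightField (cosP, a₂)) (rightField (sinP, a₁)) C ∧
      ∀ p ∈ points, 0 < metric p ((4 : ℝ) • C p) (rightField (cosP, a₂) p)) ∧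
    (∃ (a₁ a₂ : ℝ) (C : Coord → Coord),
      IsCurvature (rightField (sinP, a₁)) (rightField (cosP, a₂)) (rightField (sinP, a₁)) C ∧
      ∀ p ∈ points, metric p ((4 : ℝ) • C p) (rightField (cosP, a₂) p) < 0) := by
  refine ⟨fun X₁ X₂ X₃ => ?_, fun h₁ h₂ h₃ a₁ a₂ a₃ C hC p hp => ?_,
    fun h₁ h₂ h₃ a₁ a₂ a₃ C hC p hp => ?_, fun h₁ h₂ a₁ a₂ C hC p hp => ?_,
    fun a₁ a₂ C hC p hp => ?_, ?_, ?_⟩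
  · simp only [← invField_virEquiv, isCurvature_iff]
    exact ⟨⟨_, fun _ _ => rfl⟩, fun C C' hC hC' p hp => (hC p hp).trans (hC' p hp).symm⟩
  · exact rightTriv_curvature_eq_entries hC hp
  · exact rightTriv_curvature_eq hC hp
  · exact metric_curvature_eq hC hp
  · exact metric_curvature_sin_cos hC hp
  -- The value for `a₁ = a₂ = 0` is `π (3π - 8) > 0`.
  · have hC := (isCurvature_rightField_iff (h₁ := sinP) (h₂ := cosP) (h₃ := sinP) (a₁ := 0)
      (a₂ := 0) (a₃ := 0)).2 fun _ _ => rfl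
    refine ⟨0, 0, _, hC, fun p hp => ?_⟩
    rw [metric_curvature_sin_cos hC hp]
    nlinarith [Real.pi_gt_d2]
  -- The value for `a₁ = 2`, `a₂ = 0` is `π (3π - 12) < 0`.
  · have hC := (isCurvature_rightField_iff (h₁ := sinP) (h₂ := cosP) (h₃ := sinP) (a₁ := 2)
      (a₂ := 0) (a₃ := 2)).2 fun _ _ => rfl
    refine ⟨2, 0, _, hC, fun p hp => ?_⟩
    rw [metric_curvature_sin_cos hC hp]
    nlinarith [Real.pi_gt_d2, Real.pi_lt_d2]
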